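/- Let $G$ be a connected almost abelian Lie group (i.e. a connected finite-dimensional real Lie group whose Lie algebra has an abelian ideal of codimension one), equipped with a left-invariant Riemannian metric $g$, and let $\nabla$ be its Levi-Civita connection. For $p\ge 0$, a symmetric Killing $p$-tensor on $G$ is a smooth section $K$ of $\mathrm{Sym}^p(TG)$ such that $$\sum_i e_i\cdot\nabla_{e_i}K=0$$ for local orthonormal frames $(e_i)$, where $\cdot$ denotes the symmetric product; a Killing vector field is a symmetric Killing $1$-tensor. The metric is viewed as a symmetric $2$-tensor, $g=\frac12\sum_i e_i\cdot e_i$. Then every left-invariant symmetric Killing $p$-tensor on $G$ is a polynomial (with real coefficients, for the symmetric product) in $g$ and in Killing vector fields of $G$ each of which is right-invariant or left-invariant. In particular, every such tensor is decomposable, i.e. it belongs to $\mathbb R[g,\mathscr K^1(G)]$, where $\mathscr K^1(G)$ is the space of all Killing vector fields of $G$. -/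

import Mathlib

open Bundle Filter
open scoped Manifold ContDiff Topology

noncomputable section

/-! ### Symmetric tensor fields -/

section SymmetricTensors

/-- `Sym^p(V)`, as the homogeneous part of degree `p` of the symmetric algebra `Sym^•(V)`,
i.e. the span of the symmetric products `v₁ ⬝ … ⬝ v_p`. Over `ℝ` the algebra `Sym^•(V)` is
identified with the space of symmetric tensors, with product
`v₁ ⬝ … ⬝ v_p = ∑ σ, v_{σ 1} ⊗ … ⊗ v_{σ p}`. -/
def SymPower (V : Type*) [AddCommGroup V] [Module ℝ V] (p : ℕ) :
    Submodule ℝ (SymmetricAlgebra ℝ V) :=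
  LinearMap.range (SymmetricAlgebra.ι ℝ V) ^ p

/-- The algebra morphism `Sym^•(V) → Sym^•(W)` induced by a linear map `V → W`. -/
def symMap {V W : Type*} [AddCommGroup V] [Module ℝ V] [AddCommGroup W] [Module ℝ W]
    (f : V →ₗ[ℝ] W) : SymmetricAlgebra ℝ V →ₐ[ℝ] SymmetricAlgebra ℝ W :=
  SymmetricAlgebra.lift (SymmetricAlgebra.ι ℝ W ∘ₗ f)

end SymmetricTensors

section Manifold

variable (E : Type*) [NormedAddCommGroup E] [NormedSpace ℝ E]
  (M : Type*) [TopologicalSpace M] [ChartedSpace E M]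

/-- A (not necessarily smooth) vector field on `M`. -/
abbrev VField : Type _ := (x : M) → TangentSpace 𝓘(ℝ, E) x

/-- A (not necessarily smooth) section of `Sym^•(TM)`. These sections form a commutative
`ℝ`-algebra for the pointwise symmetric product. -/
abbrev SymField : Type _ := (x : M) → SymmetricAlgebra ℝ (TangentSpace 𝓘(ℝ, E) x)

variable {M}

/-- A real function, seen as a symmetric `0`-tensor field. -/
def SymField.ofFun (f : M → ℝ) : SymField E M := fun x ↦
  algebraMap ℝ (SymmetricAlgebra ℝ (TangentSpace 𝓘(ℝ, E) x)) (f x)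

variable {E}

/-- A vector field, seen as a symmetric `1`-tensor field. -/
def SymField.ofVField (X : VField E M) : SymField E M := fun x ↦
  SymmetricAlgebra.ι ℝ (TangentSpace 𝓘(ℝ, E) x) (X x)

/-- Smoothness of a vector field at a point. -/
def SmoothVFieldAt [IsManifold 𝓘(ℝ, E) ∞ M] (X : VField E M) (x : M) : Prop :=
  ContMDiffAt 𝓘(ℝ, E) (𝓘(ℝ, E).prod 𝓘(ℝ, E)) ∞
    (fun y ↦ (TotalSpace.mk' E y (X y) : TangentBundle 𝓘(ℝ, E) M)) x

/-- Differentiability of a vector field at a point. -/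
def DiffVFieldAt [IsManifold 𝓘(ℝ, E) ∞ M] (X : VField E M) (x : M) : Prop :=
  MDifferentiableAt 𝓘(ℝ, E) (𝓘(ℝ, E).prod 𝓘(ℝ, E))
    (fun y ↦ (TotalSpace.mk' E y (X y) : TangentBundle 𝓘(ℝ, E) M)) x

/-- A section of `Sym^•(TM)` is smooth at `x` if, near `x`, it is a polynomial expression in
functions and vector fields that are smooth at `x`. -/
def SymField.SmoothAt [IsManifold 𝓘(ℝ, E) ∞ M] (K : SymField E M) (x : M) : Prop :=
  ∃ K' ∈ Algebra.adjoin ℝ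
      ({S : SymField E M | ∃ f : M → ℝ, ContMDiffAt 𝓘(ℝ, E) 𝓘(ℝ, ℝ) ∞ f x ∧
          S = SymField.ofFun E f} ∪
        {S : SymField E M | ∃ X : VField E M, SmoothVFieldAt X x ∧ S = SymField.ofVField X}),
    ∀ᶠ y in 𝓝 x, K y = K' y

/-- A smooth section of the bundle `Sym^p(TM)`. -/
structure IsSymTensor [IsManifold 𝓘(ℝ, E) ∞ M] (p : ℕ) (K : SymField E M) : Prop where
  smooth : ∀ x, K.SmoothAt x
  degree : ∀ x, K x ∈ SymPower (TangentSpace 𝓘(ℝ, E) x) p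

/-- `HasSymCovDerivAt cov x K D` says that `v ↦ D v` is the covariant derivative `v ↦ ∇_v K` of
the section `K` of `Sym^•(TM)` at `x`, for the connection on `Sym^•(TM)` induced by the
connection `cov` of `TM`: this is the local operator which is the differential on functions,
is `cov` on vector fields, is additive, and satisfies the Leibniz rule for the symmetric
product. -/
inductive HasSymCovDerivAt [IsManifold 𝓘(ℝ, E) ∞ M]
    (cov : CovariantDerivative 𝓘(ℝ, E) E (fun x : M ↦ TangentSpace 𝓘(ℝ, E) x)) (x : M) :
    SymField E M →
      (TangentSpace 𝓘(ℝ, E) x → SymmetricAlgebra ℝ (TangentSpace 𝓘(ℝ, E) x)) → Prop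
  | ofFun (f : M → ℝ) (hf : MDifferentiableAt 𝓘(ℝ, E) 𝓘(ℝ, ℝ) f x) :
      HasSymCovDerivAt cov x (SymField.ofFun E f)
        (fun v ↦ algebraMap ℝ _ (mvfderiv 𝓘(ℝ, E) f x v))
  | ofVField (X : VField E M) (hX : DiffVFieldAt X x) :
      HasSymCovDerivAt cov x (SymField.ofVField X)
        (fun v ↦ SymmetricAlgebra.ι ℝ _ (cov X x v))
  | add {K K' : SymField E M}
      {D D' : TangentSpace 𝓘(ℝ, E) x → SymmetricAlgebra ℝ (TangentSpace 𝓘(ℝ, E) x)} :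
      HasSymCovDerivAt cov x K D → HasSymCovDerivAt cov x K' D' →
      HasSymCovDerivAt cov x (K + K') (fun v ↦ D v + D' v)
  | mul {K K' : SymField E M}
      {D D' : TangentSpace 𝓘(ℝ, E) x → SymmetricAlgebra ℝ (TangentSpace 𝓘(ℝ, E) x)} :
      HasSymCovDerivAt cov x K D → HasSymCovDerivAt cov x K' D' →
      HasSymCovDerivAt cov x (K * K') (fun v ↦ D v * K' x + K x * D' v)
  | congr {K K' : SymField E M}
      {D : TangentSpace 𝓘(ℝ, E) x → SymmetricAlgebra ℝ (TangentSpace 𝓘(ℝ, E) x)} :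
      HasSymCovDerivAt cov x K D → (∀ᶠ y in 𝓝 x, K' y = K y) → HasSymCovDerivAt cov x K' D

end Manifold

/-! ### Killing tensors on a Riemannian manifold -/

section Riemannian

variable {E : Type*} [NormedAddCommGroup E] [NormedSpace ℝ E] [FiniteDimensional ℝ E]
  {M : Type*} [TopologicalSpace M] [ChartedSpace E M] [IsManifold 𝓘(ℝ, E) ∞ M]
  [RiemannianBundle (fun x : M ↦ TangentSpace 𝓘(ℝ, E) x)]
  [IsContMDiffRiemannianBundle 𝓘(ℝ, E) ∞ E (fun x : M ↦ TangentSpace 𝓘(ℝ, E) x)]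

/-- The Levi-Civita connection: metric and torsion free. -/
structure IsLeviCivita
    (cov : CovariantDerivative 𝓘(ℝ, E) E (fun x : M ↦ TangentSpace 𝓘(ℝ, E) x)) : Prop where
  metric : CovariantDerivative.IsMetricCompatible (F := E)
    (V := fun x : M ↦ TangentSpace 𝓘(ℝ, E) x) cov
  torsionFree : cov.torsion = 0

instance instFiniteDimensionalTangentSpaceModel (x : M) :
    FiniteDimensional ℝ (TangentSpace 𝓘(ℝ, E) x) :=
  inferInstanceAs (FiniteDimensional ℝ E)

variable (E M) in
/-- An orthonormal basis of `T_xM`. Nothing below depends on its choice. -/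
def tangentONB (x : M) :
    OrthonormalBasis (Fin (Module.finrank ℝ (TangentSpace 𝓘(ℝ, E) x))) ℝ
      (TangentSpace 𝓘(ℝ, E) x) :=
  stdOrthonormalBasis ℝ (TangentSpace 𝓘(ℝ, E) x)

variable (E M) in
/-- The Riemannian metric, seen as a symmetric `2`-tensor field:
`g = (1/2) ∑ i, e_i ⬝ e_i = ∑ i, e_i ⊗ e_i` for any orthonormal basis `e`. -/
def metricTensor : SymField E M := fun x ↦
  (1 / 2 : ℝ) • ∑ i, SymmetricAlgebra.ι ℝ (TangentSpace 𝓘(ℝ, E) x) (tangentONB E M x i) *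
    SymmetricAlgebra.ι ℝ (TangentSpace 𝓘(ℝ, E) x) (tangentONB E M x i)

/-- A symmetric Killing `p`-tensor: a smooth section `K` of `Sym^p(TM)` such that
`d K = ∑ i, e_i ⬝ ∇_{e_i} K` vanishes, where `∇` is the Levi-Civita connection. -/
def IsKillingTensor (p : ℕ) (K : SymField E M) : Prop :=
  IsSymTensor p K ∧
    ∃ cov : CovariantDerivative 𝓘(ℝ, E) E (fun x : M ↦ TangentSpace 𝓘(ℝ, E) x),
      IsLeviCivita cov ∧
      ∀ x : M, ∃ D, HasSymCovDerivAt cov x K D ∧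
        ∑ i, SymmetricAlgebra.ι ℝ (TangentSpace 𝓘(ℝ, E) x) (tangentONB E M x i) *
          D (tangentONB E M x i) = 0

/-- A Killing vector field: a symmetric Killing `1`-tensor. -/
def IsKillingVField (X : VField E M) : Prop := IsKillingTensor 1 (SymField.ofVField X)

/-- A symmetric Killing `p`-tensor is decomposable if it is a polynomial (for the symmetric
product, with real coefficients) in the metric and the Killing vector fields. -/
def IsDecomposable (p : ℕ) (K : SymField E M) : Prop :=
  IsKillingTensor p K ∧
    K ∈ Algebra.adjoin ℝ ({metricTensor E M} ∪
      {S : SymField E M | ∃ X : VField E M, IsKillingVField X ∧ S = SymField.ofVField X})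

end Riemannian

/-! ### Lie groups -/

section LieGroups

variable {E : Type*} [NormedAddCommGroup E] [NormedSpace ℝ E]
  {G : Type*} [TopologicalSpace G] [ChartedSpace E G] [Group G]

/-- Left-invariance of a section of `Sym^•(TG)`: `(L_a)_* K = K` for all `a`. -/
def SymField.IsLeftInvariant (K : SymField E G) : Prop :=
  ∀ a u : G, symMap (mfderiv 𝓘(ℝ, E) 𝓘(ℝ, E) (fun y : G ↦ a * y) u).toLinearMap (K u) = K (a * u)

/-- Left-invariance of a vector field: `(L_a)_* X = X` for all `a`. -/
def VField.IsLeftInvariant (X : VField E G) : Prop :=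
  ∀ a u : G, mfderiv 𝓘(ℝ, E) 𝓘(ℝ, E) (fun y : G ↦ a * y) u (X u) = X (a * u)

/-- Right-invariance of a vector field: `(R_a)_* X = X` for all `a`. -/
def VField.IsRightInvariant (X : VField E G) : Prop :=
  ∀ a u : G, mfderiv 𝓘(ℝ, E) 𝓘(ℝ, E) (fun y : G ↦ y * a) u (X u) = X (u * a)

variable (E G)

/-- Left-invariance of the Riemannian metric of `G`: left translations are isometries. -/
def IsLeftInvariantMetric [RiemannianBundle (fun x : G ↦ TangentSpace 𝓘(ℝ, E) x)] : Prop :=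
  ∀ (a u : G) (v w : TangentSpace 𝓘(ℝ, E) u),
    inner ℝ (mfderiv 𝓘(ℝ, E) 𝓘(ℝ, E) (fun y : G ↦ a * y) u v)
      (mfderiv 𝓘(ℝ, E) 𝓘(ℝ, E) (fun y : G ↦ a * y) u w) = inner ℝ v w

instance instLieGroupMinSmoothness [LieGroup 𝓘(ℝ, E) ∞ G] :
    LieGroup 𝓘(ℝ, E) (minSmoothness ℝ 3) G :=
  LieGroup.of_le (n := ∞) (by
    rw [minSmoothness_of_isRCLikeNormedField]
    exact WithTop.coe_le_coe.2 le_top)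

/-- A Lie algebra is almost abelian if it has an abelian ideal of codimension one. -/
def IsAlmostAbelian (L : Type*) [LieRing L] [LieAlgebra ℝ L] : Prop :=
  ∃ 𝔥 : LieIdeal ℝ L, IsLieAbelian 𝔥 ∧ Module.finrank ℝ (L ⧸ 𝔥.toSubmodule) = 1

/-- A Lie group is almost abelian if its Lie algebra is. -/
def IsAlmostAbelianGroup [FiniteDimensional ℝ E] [LieGroup 𝓘(ℝ, E) ∞ G] : Prop :=
  IsAlmostAbelian (GroupLieAlgebra 𝓘(ℝ, E) G)

end LieGroups

end

noncomputable section

/-! ### Derivations of a polynomial ring and energy decomposition -/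

section Algebra

open Polynomial

variable {R : Type*} [CommRing R] [Algebra ℝ R]

/-! Evaluated on linear forms, a left-invariant symmetric tensor is a polynomial `k` on the dual of
the Lie algebra, and the Killing equation says that `k` is a first integral of the Euler equations
of the metric. Take an orthonormal basis `e, w i` of the Lie algebra with the `w i` spanning the
abelian ideal, and let `M` be the matrix of `ad e` on that ideal. Write `k` as a polynomial in `X`
(the variable of `e`) whose coefficients are polynomials in the `w i`. The Euler vector field
becomes `X * D - Q * d/dX`, where `D` is the linear vector field of `M` and `Q` its quadratic form.
With `N = ∑ (w i)²` one has `D N = 2 * Q`, so the energy `X² + N`, which is twice the metric, is a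
first integral.

Splitting `k = a(X² + N) + X * b(X² + N)`, the equation separates into `D a = 0` and `(X - N) * D b
= Q * b`, where `D` acts on coefficients and `X` now stands for the energy. If `Q ≠ 0`, the second
equation makes `b² * (X - N)` a polynomial with `D`-constant coefficients that vanishes at `N`.
Since `D N ≠ 0`, the element `N` is transcendental over the constants of `D`, hence `b = 0`. If `Q =
0`, then `D b = 0`. This is `exists_energy_decomposition`.

It remains to recognize Killing fields. The ideal is abelian, so `Ad` acts on it infinitesimally
through multiples of `M`. On a connected group a polynomial in the `w i` killed by `D` is therefore
`Ad`-invariant, and it gives the same tensor whether the `w i` are extended as left-invariant or as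
right-invariant fields (`aeval_leftField`). Right-invariant fields are Killing for a left-invariant
metric. The factor `X` survives only if `Q = 0`, that is, if `M` is skew-symmetric, and in that case
the left-invariant field of `e` is itself Killing. -/

/-- The derivation of `R[X]` which acts as `D` on coefficients and kills `X`. -/
def coeffDerivation (D : Derivation ℝ R R) : Derivation ℝ R[X] R[X] :=
  (PolynomialModule.equivPolynomialSelf (R := R)).toLinearMap.compDer D.mapCoeffs

lemma coeff_coeffDerivation (D : Derivation ℝ R R) (p : R[X]) (n : ℕ) :
    (coeffDerivation D p).coeff n = D (p.coeff n) := rfl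

lemma coeffDerivation_C (D : Derivation ℝ R R) (c : R) :
    coeffDerivation D (C c) = C (D c) := by
  ext n
  rw [coeff_coeffDerivation, coeff_C, coeff_C]
  split_ifs <;> simp

lemma coeffDerivation_X (D : Derivation ℝ R R) : coeffDerivation D (X : R[X]) = 0 := by
  ext n
  rw [coeff_coeffDerivation, coeff_X]
  split_ifs <;> simp

lemma coeffDerivation_comp (D : Derivation ℝ R R) (a p : R[X]) :
    coeffDerivation D (a.comp p) =
      (coeffDerivation D a).comp p + (derivative a).comp p * coeffDerivation D p := by
  induction a using Polynomial.induction_on' with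
  | add a b ha hb => simp only [map_add, add_comp, ha, hb]; ring
  | monomial n c =>
    rw [← C_mul_X_pow_eq_monomial]
    simp only [mul_comp, C_comp, pow_comp, X_comp, Derivation.leibniz, coeffDerivation_C,
      Derivation.leibniz_pow, coeffDerivation_X, smul_eq_mul, derivative_mul, derivative_C,
      derivative_X_pow, add_comp, zero_comp, natCast_comp, nsmul_eq_mul, mul_zero, map_natCast]
    ring

variable [IsDomain R] [CharZero R]

/-- An element which is not constant for a derivation is transcendental over the constants. -/
lemma eq_zero_of_eval_eq_zero (D : Derivation ℝ R R) {N : R} (hN : D N ≠ 0) :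
    ∀ (n : ℕ) (P : R[X]), P.natDegree ≤ n → coeffDerivation D P = 0 → P.eval N = 0 → P = 0 := by
  intro n
  induction n with
  | zero =>
    intro P hP _ h0
    rw [eq_C_of_natDegree_le_zero hP] at h0 ⊢
    simpa using h0
  | succ n ih =>
    intro P hP hD h0
    -- Applying `D` to the relation `P(N) = 0`, whose coefficients are constants, gives `P'(N) * D N
    -- = 0`. So `P'` is a relation of smaller degree, hence zero by induction, and `P` is constant.
    have h1 : P.comp (C N) = 0 := by simp [comp_C, h0]
    have h2 := coeffDerivation_comp D P (C N)
    rw [h1, hD, map_zero, zero_comp, zero_add, coeffDerivation_C, comp_C, ← C_mul, eq_comm,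
      C_eq_zero, mul_eq_zero, or_iff_left hN] at h2
    have h3 : derivative P = 0 := by
      refine ih _ ((natDegree_derivative_le P).trans (by omega)) ?_ h2
      ext k
      have h4 : D (P.coeff (k + 1)) = 0 := by
        rw [← coeff_coeffDerivation, hD, coeff_zero]
      rw [coeff_coeffDerivation, coeff_derivative, Derivation.leibniz, h4]
      have : D ((k : R) + 1) = 0 := by
        rw [map_add, Derivation.map_natCast, Derivation.map_one_eq_zero, add_zero]
      simp [this]
    refine ih P ?_ hD h0
    rw [derivative_eq_zero.1 h3]
    exact Nat.zero_le _

/-- The hypothesis is a linear differential equation for `b`; its quadratic consequence `D (b² * (X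
- N)) = 2 * b * (Q * b) - b² * 2 * Q = 0` turns it into a statement about constants of `D`. This
polynomial vanishes at `N`, which is transcendental over those constants. -/
lemma eq_zero_of_oddPart (D : Derivation ℝ R R) {N Q : R} (hN : D N = 2 * Q) (hQ : Q ≠ 0)
    {b : R[X]} (hb : (X - C N) * coeffDerivation D b = C Q * b) : b = 0 := by
  have hN' : D N ≠ 0 := by rw [hN]; exact mul_ne_zero two_ne_zero hQ
  have hP : b ^ 2 * (X - C N) = 0 := by
    refine eq_zero_of_eval_eq_zero D hN' _ _ le_rfl ?_ (by simp)
    simp only [Derivation.leibniz, Derivation.leibniz_pow, map_sub, coeffDerivation_X,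
      coeffDerivation_C, hN, smul_eq_mul, nsmul_eq_mul]
    rw [C_mul]
    simp only [map_ofNat, Nat.cast_ofNat]
    linear_combination (2 * b) * hb
  simpa [X_sub_C_ne_zero] using hP

/-- `S[X]` is generated by `1` and `X` as a module over the polynomials in `X² + N`. -/
lemma exists_comp_add_X_mul_comp {S : Type*} [CommRing S] (N : S) (k : S[X]) :
    ∃ a b : S[X], k = a.comp (X ^ 2 + C N) + X * b.comp (X ^ 2 + C N) := by
  induction k using Polynomial.induction_on with
  | C c => exact ⟨C c, 0, by simp⟩
  | add p q hp hq =>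
    obtain ⟨a, b, rfl⟩ := hp
    obtain ⟨a', b', rfl⟩ := hq
    exact ⟨a + a', b + b', by simp only [add_comp]; ring⟩
  | monomial n c h =>
    obtain ⟨a, b, h⟩ := h
    -- Multiplication by `X` exchanges the two parts, since `X * X = (X² + N) - N`.
    refine ⟨(X - C N) * b, a, ?_⟩
    rw [pow_succ, ← mul_assoc, h]
    simp only [mul_comp, sub_comp, X_comp, C_comp]
    ring

/-- Parity of degrees: the first summand has even degree and the second odd degree, so they cannot
cancel. -/
lemma comp_add_X_mul_comp_eq_zero {S : Type*} [CommRing S] [IsDomain S] {N : S} {a b : S[X]}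
    (h : a.comp (X ^ 2 + C N) + X * b.comp (X ^ 2 + C N) = 0) : a = 0 ∧ b = 0 := by
  have hp : (X ^ 2 + C N : S[X]).natDegree = 2 := natDegree_X_pow_add_C
  have hcomp : ∀ a : S[X], a.comp (X ^ 2 + C N) = 0 → a = 0 := by
    intro a ha
    rcases comp_eq_zero_iff.1 ha with ha | ⟨-, ha⟩
    · exact ha
    · rw [ha, natDegree_C] at hp
      omega
  by_cases hb : b = 0
  · subst hb
    exact ⟨hcomp a (by simpa using h), rfl⟩
  · have hb' : b.comp (X ^ 2 + C N) ≠ 0 := fun h ↦ hb (hcomp b h)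
    have h1 : a.comp (X ^ 2 + C N) = - (X * b.comp (X ^ 2 + C N)) := by linear_combination h
    have h2 := congrArg natDegree h1
    rw [natDegree_neg, natDegree_comp, hp, natDegree_X_mul hb', natDegree_comp, hp] at h2
    omega

/-- A first integral of the Euler equations splits into an even part and an odd part,
the odd part being trivial unless `Q = 0`. -/
theorem exists_energy_decomposition (D : Derivation ℝ R R) {N Q : R} (hN : D N = 2 * Q) {k : R[X]}
    (hk : X * coeffDerivation D k - C Q * derivative k = 0) :
    ∃ a b : R[X], k = a.comp (X ^ 2 + C N) + X * b.comp (X ^ 2 + C N) ∧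
      coeffDerivation D a = 0 ∧ coeffDerivation D b = 0 ∧ (b = 0 ∨ Q = 0) := by
  obtain ⟨a, b, rfl⟩ := exists_comp_add_X_mul_comp N k
  have hp : coeffDerivation D (X ^ 2 + C N) = 2 * C Q := by
    simp only [map_add, Derivation.leibniz_pow, coeffDerivation_X, coeffDerivation_C, hN, C_mul,
      smul_zero, zero_add]
    rw [map_ofNat]
  have hp' : derivative (X ^ 2 + C N : R[X]) = 2 * X := by simp [one_add_one_eq_two, map_ofNat]
  -- The Euler derivation kills `X² + N`, so it only meets the coefficients of `a` and `b` and the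
  -- isolated factor `X`. The remaining `X²` is rewritten as energy minus `N`, which puts the result
  -- again in even-plus-odd form.
  have key : ((X - C N) * coeffDerivation D b - C Q * b).comp (X ^ 2 + C N) +
      X * (coeffDerivation D a).comp (X ^ 2 + C N) = 0 := by
    rw [← hk]
    simp only [map_add, Derivation.leibniz, coeffDerivation_comp, coeffDerivation_X, hp,
      derivative_comp, hp', derivative_mul, derivative_X, smul_eq_mul, sub_comp, mul_comp, X_comp,
      C_comp]
    ring
  obtain ⟨h1, h2⟩ := comp_add_X_mul_comp_eq_zero key
  refine ⟨a, b, rfl, h2, ?_⟩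
  by_cases hQ : Q = 0
  · refine ⟨?_, Or.inr hQ⟩
    rw [hQ, C_0, zero_mul, sub_zero] at h1
    exact (mul_eq_zero.1 h1).resolve_left (X_sub_C_ne_zero N)
  · have hb : b = 0 := eq_zero_of_oddPart D hN hQ (sub_eq_zero.1 h1)
    exact ⟨by rw [hb, map_zero], Or.inl hb⟩

end Algebra

/-! ### Symmetric tensors as polynomial functions -/

section Evaluation

variable {V W : Type*} [AddCommGroup V] [Module ℝ V] [AddCommGroup W] [Module ℝ W]

/-- Evaluation of symmetric tensors on a linear form. -/
def symEval (α : V →ₗ[ℝ] ℝ) : SymmetricAlgebra ℝ V →ₐ[ℝ] ℝ := SymmetricAlgebra.lift α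

@[simp] lemma symEval_ι (α : V →ₗ[ℝ] ℝ) (v : V) : symEval α (SymmetricAlgebra.ι ℝ V v) = α v :=
  SymmetricAlgebra.lift_ι_apply α v

@[simp] lemma symMap_ι (f : V →ₗ[ℝ] W) (v : V) :
    symMap f (SymmetricAlgebra.ι ℝ V v) = SymmetricAlgebra.ι ℝ W (f v) :=
  SymmetricAlgebra.lift_ι_apply _ v

lemma symEval_symMap (f : V →ₗ[ℝ] W) (α : W →ₗ[ℝ] ℝ) (k : SymmetricAlgebra ℝ V) :
    symEval α (symMap f k) = symEval (α ∘ₗ f) k := by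
  have : (symEval α).comp (symMap f) = symEval (α ∘ₗ f) := by
    apply SymmetricAlgebra.algHom_ext
    ext v
    simp
  exact DFunLike.congr_fun this k

/-- Symmetric tensors are determined by their values on linear forms. -/
lemma symEval_injective {x y : SymmetricAlgebra ℝ V} (h : ∀ α, symEval α x = symEval α y) :
    x = y := by
  let b := Module.Basis.ofVectorSpace ℝ V
  apply (SymmetricAlgebra.equivMvPolynomial b).injective
  apply MvPolynomial.funext
  intro z
  have key : ∀ x, MvPolynomial.eval z (SymmetricAlgebra.equivMvPolynomial b x) =
      symEval (b.constr ℝ z) x := by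
    intro x
    have : (MvPolynomial.aeval z).comp (SymmetricAlgebra.equivMvPolynomial b).toAlgHom =
        symEval (b.constr ℝ z) := by
      apply SymmetricAlgebra.algHom_ext
      apply b.ext
      intro i
      simp [SymmetricAlgebra.equivMvPolynomial_ι_apply, Module.Basis.constr_basis]
    have := DFunLike.congr_fun this x
    simpa [MvPolynomial.aeval_eq_eval] using this
  rw [key, key, h]

open TrivSqZeroExt in
/-- Evaluation of symmetric tensors on the first order jet `α + ε γ` of linear forms. -/
def symEvalJet (α γ : V →ₗ[ℝ] ℝ) : SymmetricAlgebra ℝ V →ₐ[ℝ] DualNumber ℝ :=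
  SymmetricAlgebra.lift ((inlAlgHom ℝ ℝ ℝ).toLinearMap ∘ₗ α + inrHom ℝ ℝ ∘ₗ γ)

open TrivSqZeroExt in
lemma symEvalJet_ι (α γ : V →ₗ[ℝ] ℝ) (v : V) :
    symEvalJet α γ (SymmetricAlgebra.ι ℝ V v) = inl (α v) + inr (γ v) :=
  SymmetricAlgebra.lift_ι_apply _ v

/-- The derivative at `α` in the direction `γ` of the polynomial function given by a symmetric
tensor. -/
def symDeriv (α γ : V →ₗ[ℝ] ℝ) (x : SymmetricAlgebra ℝ V) : ℝ := (symEvalJet α γ x).snd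

lemma fst_symEvalJet (α γ : V →ₗ[ℝ] ℝ) (x : SymmetricAlgebra ℝ V) :
    (symEvalJet α γ x).fst = symEval α x := by
  have : (TrivSqZeroExt.fstHom ℝ ℝ ℝ).comp (symEvalJet α γ) = symEval α := by
    apply SymmetricAlgebra.algHom_ext
    ext v
    simp [symEvalJet_ι]
  exact DFunLike.congr_fun this x

@[simp] lemma symDeriv_ι (α γ : V →ₗ[ℝ] ℝ) (v : V) :
    symDeriv α γ (SymmetricAlgebra.ι ℝ V v) = γ v := by
  simp [symDeriv, symEvalJet_ι]

@[simp] lemma symDeriv_algebraMap (α γ : V →ₗ[ℝ] ℝ) (r : ℝ) :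
    symDeriv α γ (algebraMap ℝ _ r) = 0 := by
  simp [symDeriv, TrivSqZeroExt.algebraMap_eq_inl]

lemma symDeriv_add (α γ : V →ₗ[ℝ] ℝ) (x y : SymmetricAlgebra ℝ V) :
    symDeriv α γ (x + y) = symDeriv α γ x + symDeriv α γ y := by
  simp [symDeriv]

lemma symDeriv_mul (α γ : V →ₗ[ℝ] ℝ) (x y : SymmetricAlgebra ℝ V) :
    symDeriv α γ (x * y) = symEval α x * symDeriv α γ y + symDeriv α γ x * symEval α y := by
  simp [symDeriv, ← fst_symEvalJet α γ]

/-- Linearity in the direction collapses the contraction `∑ e_i ⬝ ∇_{e_i} K`, evaluated on a linear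
form, into one directional derivative. -/
lemma symDeriv_sum_smul {κ : Type*} (s : Finset κ) (c : κ → ℝ) (α : V →ₗ[ℝ] ℝ) (γ : κ → V →ₗ[ℝ] ℝ)
    (x : SymmetricAlgebra ℝ V) :
    symDeriv α (∑ i ∈ s, c i • γ i) x = ∑ i ∈ s, c i * symDeriv α (γ i) x := by
  induction x using SymmetricAlgebra.induction with
  | algebraMap r => simp
  | ι v => simp
  | mul x y hx hy =>
    simp only [symDeriv_mul, hx, hy, Finset.mul_sum, Finset.sum_mul, ← Finset.sum_add_distrib]
    exact Finset.sum_congr rfl fun i _ ↦ by ring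
  | add x y hx hy =>
    simp only [symDeriv_add, hx, hy, mul_add, Finset.sum_add_distrib]

end Evaluation

/-! ### Polynomials in an adapted basis and the Euler vector field -/

section PolyEval

open Polynomial

variable {ι : Type*} {S T : Type*} [CommRing S] [Algebra ℝ S] [CommRing T] [Algebra ℝ T]

/-- Substitution of `w i` for the variables of the coefficients and of `e` for `X`. -/
def polyEval (w : ι → S) (e : S) : (MvPolynomial ι ℝ)[X] →ₐ[ℝ] S :=
  Polynomial.eval₂AlgHom (MvPolynomial.aeval w) e (fun _ ↦ Commute.all _ _)

lemma polyEval_X (w : ι → S) (e : S) : polyEval w e X = e := by simp [polyEval]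

lemma polyEval_C (w : ι → S) (e : S) (c : MvPolynomial ι ℝ) :
    polyEval w e (C c) = MvPolynomial.aeval w c := by simp [polyEval]

lemma map_polyEval (φ : S →ₐ[ℝ] T) (w : ι → S) (e : S) (k : (MvPolynomial ι ℝ)[X]) :
    φ (polyEval w e k) = polyEval (fun i ↦ φ (w i)) (φ e) k := by
  induction k using Polynomial.induction_on' with
  | add p q hp hq => simp only [map_add, hp, hq]
  | monomial n c =>
    rw [← C_mul_X_pow_eq_monomial]
    simp only [map_mul, map_pow, polyEval_X, polyEval_C]
    congr 1
    rw [MvPolynomial.aeval_def, MvPolynomial.aeval_def, ← AlgHom.coe_toRingHom,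
      MvPolynomial.hom_eval₂]
    simp

lemma eq_zero_of_polyEval_eq_zero {k : (MvPolynomial ι ℝ)[X]}
    (h : ∀ (v : ι → ℝ) (s : ℝ), polyEval v s k = 0) : k = 0 := by
  ext1 n
  apply MvPolynomial.funext
  intro v
  have h1 : k.map (MvPolynomial.aeval v : MvPolynomial ι ℝ →ₐ[ℝ] ℝ).toRingHom = 0 := by
    apply Polynomial.funext
    intro s
    rw [eval_map, eval_zero, ← h v s]
    rfl
  have h2 := congrArg (fun p ↦ p.coeff n) h1
  simpa [MvPolynomial.aeval_eq_eval] using h2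

variable [Fintype ι]

/-- The linear vector field with matrix `M`, as a derivation of polynomials. -/
def linearDerivation (M : ι → ι → ℝ) : Derivation ℝ (MvPolynomial ι ℝ) (MvPolynomial ι ℝ) :=
  MvPolynomial.mkDerivation ℝ fun i ↦ ∑ j, MvPolynomial.C (M i j) * MvPolynomial.X j

/-- The squared norm. -/
def normSqPoly (ι : Type*) [Fintype ι] : MvPolynomial ι ℝ := ∑ i, MvPolynomial.X i ^ 2

/-- The quadratic form of a matrix. -/
def quadPoly (M : ι → ι → ℝ) : MvPolynomial ι ℝ :=
  ∑ i, MvPolynomial.X i * ∑ j, MvPolynomial.C (M i j) * MvPolynomial.X j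

lemma linearDerivation_normSqPoly (M : ι → ι → ℝ) :
    linearDerivation M (normSqPoly ι) = 2 * quadPoly M := by
  rw [linearDerivation, normSqPoly, quadPoly, map_sum, Finset.mul_sum]
  refine Finset.sum_congr rfl fun i _ ↦ ?_
  rw [Derivation.leibniz_pow, MvPolynomial.mkDerivation_X]
  simp [two_mul]

variable {V : Type*} [AddCommGroup V] [Module ℝ V]

lemma symDeriv_aeval (M : ι → ι → ℝ) (w : ι → V) (α γ : V →ₗ[ℝ] ℝ) (t : ℝ)
    (hγ : ∀ i, γ (w i) = t * ∑ j, M i j * α (w j)) (c : MvPolynomial ι ℝ) :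
    symDeriv α γ (MvPolynomial.aeval (fun i ↦ SymmetricAlgebra.ι ℝ V (w i)) c) =
      t * MvPolynomial.aeval (fun i ↦ α (w i)) (linearDerivation M c) := by
  induction c using MvPolynomial.induction_on with
  | C a => simp [← MvPolynomial.algebraMap_eq]
  | add p q hp hq => simp only [map_add, symDeriv_add, hp, hq, mul_add]
  | mul_X p i hp =>
    -- The value `0` substituted for `X` is a dummy: `C p` does not involve `X`.
    have h1 : symEval α (MvPolynomial.aeval (fun i ↦ SymmetricAlgebra.ι ℝ V (w i)) p) =
        MvPolynomial.aeval (fun i ↦ α (w i)) p := by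
      have := map_polyEval (symEval α) (fun i ↦ SymmetricAlgebra.ι ℝ V (w i)) 0 (C p)
      simpa [polyEval_C] using this
    rw [map_mul, symDeriv_mul, hp, h1, MvPolynomial.aeval_X, symDeriv_ι, symEval_ι, hγ,
      Derivation.leibniz]
    simp only [linearDerivation, MvPolynomial.mkDerivation_X, smul_eq_mul, map_add, map_mul,
      map_sum, MvPolynomial.aeval_X, MvPolynomial.aeval_C, Algebra.algebraMap_self, RingHom.id_apply]
    ring

/-- The two hypotheses on `γ` say that it is the Euler vector field at the point `α`: proportional
to `M` along the ideal, and minus the quadratic form in the normal direction. Both sides obey the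
Leibniz rule, so generators suffice. -/
lemma symDeriv_polyEval (M : ι → ι → ℝ) (w : ι → V) (e : V) (α γ : V →ₗ[ℝ] ℝ)
    (hγ : ∀ i, γ (w i) = α e * ∑ j, M i j * α (w j))
    (hγ' : γ e = - ∑ i, α (w i) * ∑ j, M i j * α (w j)) (k : (MvPolynomial ι ℝ)[X]) :
    symDeriv α γ (polyEval (fun i ↦ SymmetricAlgebra.ι ℝ V (w i)) (SymmetricAlgebra.ι ℝ V e) k) =
      polyEval (fun i ↦ α (w i)) (α e)
        (X * coeffDerivation (linearDerivation M) k - C (quadPoly M) * derivative k) := by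
  have hev : ∀ k, symEval α (polyEval (fun i ↦ SymmetricAlgebra.ι ℝ V (w i))
      (SymmetricAlgebra.ι ℝ V e) k) = polyEval (fun i ↦ α (w i)) (α e) k := by
    intro k
    simpa using map_polyEval (symEval α) (fun i ↦ SymmetricAlgebra.ι ℝ V (w i))
      (SymmetricAlgebra.ι ℝ V e) k
  have hQ : MvPolynomial.aeval (fun i ↦ α (w i)) (quadPoly M) =
      ∑ i, α (w i) * ∑ j, M i j * α (w j) := by
    simp [quadPoly]
  induction k using Polynomial.induction_on with
  | C c =>
    rw [polyEval_C, symDeriv_aeval M w α γ _ hγ]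
    simp [coeffDerivation_C, polyEval_X, polyEval_C, mul_comm (α e)]
  | add p q hp hq =>
    simp only [map_add, symDeriv_add, hp, hq, mul_add, map_sub]
    ring
  | monomial n c h =>
    rw [pow_succ, ← mul_assoc]
    generalize C c * X ^ n = p at h ⊢
    rw [map_mul, symDeriv_mul, h, hev, polyEval_X, symDeriv_ι, symEval_ι,
      hγ', ← hQ, Derivation.leibniz, derivative_mul]
    simp only [map_sub, map_mul, map_add, polyEval_X, polyEval_C, coeffDerivation_X, derivative_X,
      smul_eq_mul, mul_zero, mul_one, zero_add]
    ring

lemma polyEval_surjective {ι V : Type*} [AddCommGroup V] [Module ℝ V] (w : ι → V) (e : V)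
    (h : Submodule.span ℝ (insert e (Set.range w)) = ⊤) :
    Function.Surjective
      (polyEval (fun i ↦ SymmetricAlgebra.ι ℝ V (w i)) (SymmetricAlgebra.ι ℝ V e)) := by
  intro x
  rw [← AlgHom.mem_range]
  induction x using SymmetricAlgebra.induction with
  | algebraMap r => exact Subalgebra.algebraMap_mem _ r
  | ι v =>
    have hv : v ∈ Submodule.span ℝ (insert e (Set.range w)) := h ▸ Submodule.mem_top
    induction hv using Submodule.span_induction with
    | mem v hv =>
      rcases hv with rfl | ⟨i, rfl⟩
      · exact ⟨X, polyEval_X _ _⟩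
      · exact ⟨C (MvPolynomial.X i), by simp [polyEval_C]⟩
    | zero => rw [map_zero]; exact Subalgebra.zero_mem _
    | add v w _ _ hv hw => rw [map_add]; exact Subalgebra.add_mem _ hv hw
    | smul c v _ hv => rw [map_smul]; exact Subalgebra.smul_mem _ hv c
  | mul x y hx hy => exact Subalgebra.mul_mem _ hx hy
  | add x y hx hy => exact Subalgebra.add_mem _ hx hy

end PolyEval

/-! ### Left and right trivializations of the tangent bundle of a Lie group -/

section Trivialization

variable {E : Type*} [NormedAddCommGroup E] [NormedSpace ℝ E]
  {G : Type*} [TopologicalSpace G] [ChartedSpace E G]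

variable (E) in
/-- The derivative of a self-map of `G`, as a linear map of the model space. -/
def modelDeriv (f : G → G) (x : G) : E →L[ℝ] E := mfderiv 𝓘(ℝ, E) 𝓘(ℝ, E) f x

lemma modelDeriv_comp {f g : G → G} (x : G) (hg : MDifferentiableAt 𝓘(ℝ, E) 𝓘(ℝ, E) g (f x))
    (hf : MDifferentiableAt 𝓘(ℝ, E) 𝓘(ℝ, E) f x) :
    modelDeriv E (g ∘ f) x = modelDeriv E g (f x) ∘L modelDeriv E f x :=
  mfderiv_comp x hg hf

lemma modelDeriv_id (x : G) : modelDeriv E (id : G → G) x = ContinuousLinearMap.id ℝ E :=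
  mfderiv_id

variable [Group G]

variable (G) in
/-- The right-invariant vector field with value `ξ` at the identity. -/
def rightField (ξ : E) : VField E G := fun u ↦
  mfderiv 𝓘(ℝ, E) 𝓘(ℝ, E) (fun y : G ↦ y * u) 1 ξ

variable (G) in
/-- The left-invariant vector field with value `ξ` at the identity. -/
def leftField (ξ : E) : VField E G := fun u ↦
  mfderiv 𝓘(ℝ, E) 𝓘(ℝ, E) (fun y : G ↦ u * y) 1 ξ

variable (E) in
/-- The derivative at `1` of the left translation by `u`. -/
def leftD (u : G) : E →L[ℝ] E := modelDeriv E (fun y : G ↦ u * y) 1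

variable (E) in
/-- The derivative at `u` of the left translation by `u⁻¹`. -/
def leftDInv (u : G) : E →L[ℝ] E := modelDeriv E (fun y : G ↦ u⁻¹ * y) u

variable (E) in
/-- The adjoint action of `u⁻¹`, as the derivative at `1` of `y ↦ u⁻¹ * y * u`. -/
def adInv (u : G) : E →L[ℝ] E := leftDInv E u ∘L modelDeriv E (fun y : G ↦ y * u) 1

/-- Expression of a vector field in the left trivialization of the tangent bundle. -/
def leftCoord (X : VField E G) (u : G) : E := leftDInv E u (X u)

lemma leftCoord_rightField (ξ : E) (u : G) : leftCoord (rightField G ξ) u = adInv E u ξ := rfl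

lemma leftField_one (ξ : E) : leftField G ξ 1 = ξ := by
  have h : (fun y : G ↦ 1 * y) = id := by ext; simp
  change modelDeriv E (fun y : G ↦ 1 * y) 1 ξ = ξ
  rw [h, modelDeriv_id]
  rfl

lemma rightField_one (ξ : E) : rightField G ξ 1 = ξ := by
  have h : (fun y : G ↦ y * 1) = id := by ext; simp
  change modelDeriv E (fun y : G ↦ y * 1) 1 ξ = ξ
  rw [h, modelDeriv_id]
  rfl

variable [LieGroup 𝓘(ℝ, E) ∞ G]

lemma mdifferentiableAt_leftTranslation (a u : G) :
    MDifferentiableAt 𝓘(ℝ, E) 𝓘(ℝ, E) (fun y : G ↦ a * y) u :=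
  (contMDiff_mul_left (I := 𝓘(ℝ, E)) (n := ∞)).contMDiffAt.mdifferentiableAt (by simp)

lemma mdifferentiableAt_rightTranslation (a u : G) :
    MDifferentiableAt 𝓘(ℝ, E) 𝓘(ℝ, E) (fun y : G ↦ y * a) u :=
  (contMDiff_mul_right (I := 𝓘(ℝ, E)) (n := ∞)).contMDiffAt.mdifferentiableAt (by simp)

/-- The differential of the multiplication. -/
def mulTangent (p : TangentBundle 𝓘(ℝ, E) G × TangentBundle 𝓘(ℝ, E) G) :
    TangentBundle 𝓘(ℝ, E) G :=
  tangentMap (𝓘(ℝ, E).prod 𝓘(ℝ, E)) 𝓘(ℝ, E) (fun q : G × G ↦ q.1 * q.2)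
    ((equivTangentBundleProd 𝓘(ℝ, E) G 𝓘(ℝ, E) G).symm p)

lemma contMDiff_mulTangent :
    ContMDiff (𝓘(ℝ, E).tangent.prod 𝓘(ℝ, E).tangent) 𝓘(ℝ, E).tangent ∞
      (mulTangent : TangentBundle 𝓘(ℝ, E) G × TangentBundle 𝓘(ℝ, E) G → _) :=
  (ContMDiff.contMDiff_tangentMap (contMDiff_mul 𝓘(ℝ, E) ∞) (m := ∞) le_rfl).comp
    contMDiff_equivTangentBundleProd_symm

lemma mulTangent_zero_left (a u : G) (v : E) :
    mulTangent (⟨a, 0⟩, ⟨u, v⟩) =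
      (⟨a * u, modelDeriv E (fun y : G ↦ a * y) u v⟩ : TangentBundle 𝓘(ℝ, E) G) := by
  have M := (contMDiff_mul 𝓘(ℝ, E) (G := G) ∞).mdifferentiable (by simp)
  have key : (mfderiv (𝓘(ℝ, E).prod 𝓘(ℝ, E)) 𝓘(ℝ, E) (fun q : G × G ↦ q.1 * q.2) (a, u) : _ → E)
      ((0 : E), (v : E)) = modelDeriv E (fun y : G ↦ y * u) a 0 + modelDeriv E (fun y : G ↦ a * y) u v :=
    mfderiv_prod_eq_add_apply (M (a, u))
  rw [map_zero, zero_add] at key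
  exact congrArg (fun w : E ↦ (⟨a * u, w⟩ : TangentBundle 𝓘(ℝ, E) G)) key

lemma mulTangent_zero_right (a u : G) (v : E) :
    mulTangent (⟨u, v⟩, ⟨a, 0⟩) =
      (⟨u * a, modelDeriv E (fun y : G ↦ y * a) u v⟩ : TangentBundle 𝓘(ℝ, E) G) := by
  have M := (contMDiff_mul 𝓘(ℝ, E) (G := G) ∞).mdifferentiable (by simp)
  have key : (mfderiv (𝓘(ℝ, E).prod 𝓘(ℝ, E)) 𝓘(ℝ, E) (fun q : G × G ↦ q.1 * q.2) (u, a) : _ → E)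
      ((v : E), (0 : E)) = modelDeriv E (fun y : G ↦ y * a) u v + modelDeriv E (fun y : G ↦ u * y) a 0 :=
    mfderiv_prod_eq_add_apply (M (u, a))
  rw [map_zero, add_zero] at key
  exact congrArg (fun w : E ↦ (⟨u * a, w⟩ : TangentBundle 𝓘(ℝ, E) G)) key

/-- The field is the differential of the multiplication applied to the zero section in the first
factor and a constant tangent vector at `1` in the second. -/
lemma contMDiff_leftField (ξ : E) :
    ContMDiff 𝓘(ℝ, E) 𝓘(ℝ, E).tangent ∞
      (fun u ↦ (⟨u, leftField G ξ u⟩ : TangentBundle 𝓘(ℝ, E) G)) := by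
  have h1 : ContMDiff 𝓘(ℝ, E) 𝓘(ℝ, E).tangent ∞
      (fun u : G ↦ (⟨u, 0⟩ : TangentBundle 𝓘(ℝ, E) G)) := contMDiff_zeroSection _ _
  have h2 : ContMDiff 𝓘(ℝ, E) 𝓘(ℝ, E).tangent ∞
      (fun _ : G ↦ (⟨1, ξ⟩ : TangentBundle 𝓘(ℝ, E) G)) := contMDiff_const
  have h3 := contMDiff_mulTangent.comp (h1.prodMk h2)
  have h4 : (fun u ↦ (⟨u, leftField G ξ u⟩ : TangentBundle 𝓘(ℝ, E) G)) =
      mulTangent ∘ fun u ↦ (⟨u, 0⟩, ⟨1, ξ⟩) := by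
    funext u
    refine Eq.trans ?_ (mulTangent_zero_left (E := E) u 1 ξ).symm
    rw [mul_one]
    rfl
  rw [h4]
  exact h3

lemma contMDiff_rightField (ξ : E) :
    ContMDiff 𝓘(ℝ, E) 𝓘(ℝ, E).tangent ∞
      (fun u ↦ (⟨u, rightField G ξ u⟩ : TangentBundle 𝓘(ℝ, E) G)) := by
  have h1 : ContMDiff 𝓘(ℝ, E) 𝓘(ℝ, E).tangent ∞
      (fun u : G ↦ (⟨u, 0⟩ : TangentBundle 𝓘(ℝ, E) G)) := contMDiff_zeroSection _ _
  have h2 : ContMDiff 𝓘(ℝ, E) 𝓘(ℝ, E).tangent ∞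
      (fun _ : G ↦ (⟨1, ξ⟩ : TangentBundle 𝓘(ℝ, E) G)) := contMDiff_const
  have h3 := contMDiff_mulTangent.comp (h2.prodMk h1)
  have h4 : (fun u ↦ (⟨u, rightField G ξ u⟩ : TangentBundle 𝓘(ℝ, E) G)) =
      mulTangent ∘ fun u ↦ (⟨1, ξ⟩, ⟨u, 0⟩) := by
    funext u
    refine Eq.trans ?_ (mulTangent_zero_right (E := E) u 1 ξ).symm
    rw [one_mul]
    rfl
  rw [h4]
  exact h3

/-- The trivialization of the tangent bundle centred at `1` is the identity on the fibre over `1`.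
-/
lemma mdifferentiableAt_of_constant_base {c : G → E} {x : G}
    (h : MDifferentiableAt 𝓘(ℝ, E) 𝓘(ℝ, E).tangent
      (fun u ↦ (⟨1, c u⟩ : TangentBundle 𝓘(ℝ, E) G)) x) :
    MDifferentiableAt 𝓘(ℝ, E) 𝓘(ℝ, E) c x := by
  have h2 := ((mdifferentiableAt_totalSpace 𝓘(ℝ, E) _).1 h).2
  refine h2.congr_of_eventuallyEq (Eventually.of_forall fun u ↦ ?_)
  exact ((tangentBundleCore 𝓘(ℝ, E) G).coordChange_self (achart E 1) 1
    (mem_chart_source E (1 : G)) (c u)).symm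

/-- The left coordinate is the differential of the multiplication at the pair formed by the zero
vector at `u⁻¹` and `X u`, hence a map into the single fibre over `1`. -/
lemma mdifferentiableAt_leftCoord {X : VField E G} {x : G} (hX : DiffVFieldAt X x) :
    MDifferentiableAt 𝓘(ℝ, E) 𝓘(ℝ, E) (leftCoord X) x := by
  apply mdifferentiableAt_of_constant_base (G := G)
  have h1 : MDifferentiableAt 𝓘(ℝ, E) 𝓘(ℝ, E).tangent
      (fun u : G ↦ (⟨u⁻¹, 0⟩ : TangentBundle 𝓘(ℝ, E) G)) x := by
    have h0 : ContMDiff 𝓘(ℝ, E) 𝓘(ℝ, E).tangent ∞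
      (fun u : G ↦ (⟨u, 0⟩ : TangentBundle 𝓘(ℝ, E) G)) := contMDiff_zeroSection _ _
    exact (h0.comp (contMDiff_inv 𝓘(ℝ, E) ∞)).contMDiffAt.mdifferentiableAt (by simp)
  have h2 : MDifferentiableAt 𝓘(ℝ, E) 𝓘(ℝ, E).tangent
      (fun u : G ↦ (⟨u, X u⟩ : TangentBundle 𝓘(ℝ, E) G)) x := hX
  have h3 := (contMDiff_mulTangent.mdifferentiable (by simp) _).comp x (h1.prodMk h2)
  have h4 : (fun u ↦ (⟨1, leftCoord (E := E) X u⟩ : TangentBundle 𝓘(ℝ, E) G)) =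
      mulTangent ∘ fun u ↦ (⟨u⁻¹, 0⟩, ⟨u, X u⟩) := by
    funext u
    refine Eq.trans ?_ (mulTangent_zero_left (E := E) u⁻¹ u (X u)).symm
    rw [inv_mul_cancel]
    rfl
  rw [h4]
  exact h3

lemma leftDInv_comp_leftD (u : G) :
    leftDInv E u ∘L leftD E u = ContinuousLinearMap.id ℝ E := by
  have h := modelDeriv_comp (E := E) (f := fun y ↦ u * y) (g := fun y ↦ u⁻¹ * y) (1 : G)
    (mdifferentiableAt_leftTranslation _ _) (mdifferentiableAt_leftTranslation _ _)
  have h' : ((fun y ↦ u⁻¹ * y) ∘ fun y ↦ u * y) = (id : G → G) := by ext; simp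
  rw [h', modelDeriv_id] at h
  simp only [mul_one] at h
  exact h.symm

lemma leftD_comp_leftDInv (u : G) :
    leftD E u ∘L leftDInv E u = ContinuousLinearMap.id ℝ E := by
  have h := modelDeriv_comp (E := E) (f := fun y ↦ u⁻¹ * y) (g := fun y ↦ u * y) u
    (mdifferentiableAt_leftTranslation _ _) (mdifferentiableAt_leftTranslation _ _)
  have h' : ((fun y ↦ u * y) ∘ fun y ↦ u⁻¹ * y) = (id : G → G) := by ext; simp
  rw [h', modelDeriv_id] at h
  simp only [inv_mul_cancel] at h
  exact h.symm

lemma leftD_mul (a u : G) : leftD E (a * u) = modelDeriv E (fun y ↦ a * y) u ∘L leftD E u := by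
  have h := modelDeriv_comp (E := E) (f := fun y ↦ u * y) (g := fun y ↦ a * y) (1 : G)
    (mdifferentiableAt_leftTranslation _ _) (mdifferentiableAt_leftTranslation _ _)
  have h' : ((fun y ↦ a * y) ∘ fun y ↦ u * y) = (fun y : G ↦ a * u * y) := by ext; simp [mul_assoc]
  rw [h'] at h
  simp only [mul_one] at h
  exact h

lemma adInv_eq (u : G) : adInv E u = modelDeriv E (fun y ↦ u⁻¹ * (y * u)) 1 := by
  have h := modelDeriv_comp (E := E) (f := fun y ↦ y * u) (g := fun y ↦ u⁻¹ * y) (1 : G)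
    (mdifferentiableAt_leftTranslation _ _) (mdifferentiableAt_rightTranslation _ _)
  simp only [one_mul] at h
  exact h.symm

/-- The order is reversed because the adjoint action is taken at the inverse. The two ways of
splitting a product later give the derivative of `adInv` along left-invariant and along
right-invariant fields. -/
lemma adInv_mul (u y : G) : adInv E (u * y) = adInv E y ∘L adInv E u := by
  have hd : ∀ u : G, MDifferentiableAt 𝓘(ℝ, E) 𝓘(ℝ, E) (fun y : G ↦ u⁻¹ * (y * u)) 1 := fun u ↦
    (mdifferentiableAt_leftTranslation u⁻¹ (1 * u)).comp (1 : G)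
      (mdifferentiableAt_rightTranslation u 1)
  have h1 : u⁻¹ * (1 * u) = 1 := by simp
  have h := modelDeriv_comp (E := E) (f := fun z ↦ u⁻¹ * (z * u)) (g := fun z ↦ y⁻¹ * (z * y))
    (1 : G) (by simpa only [h1] using hd y) (hd u)
  rw [h1] at h
  rw [adInv_eq, adInv_eq, adInv_eq, ← h]
  congr 1
  ext z
  simp [mul_assoc]

lemma adInv_one : adInv E (1 : G) = ContinuousLinearMap.id ℝ E := by
  rw [adInv_eq, ← modelDeriv_id (1 : G)]
  congr 1
  ext z
  simp

lemma leftCoord_leftField (ξ : E) (u : G) : leftCoord (leftField G ξ) u = ξ :=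
  DFunLike.congr_fun (leftDInv_comp_leftD (E := E) u) ξ

lemma leftField_leftCoord (X : VField E G) (u : G) : leftField G (leftCoord X u) u = X u :=
  DFunLike.congr_fun (leftD_comp_leftDInv (E := E) u) (X u)

lemma leftField_isLeftInvariant (ξ : E) : VField.IsLeftInvariant (leftField G ξ) := fun a u ↦
  (DFunLike.congr_fun (leftD_mul (E := E) a u) ξ).symm

lemma rightField_isRightInvariant (ξ : E) : VField.IsRightInvariant (rightField G ξ) := fun a u ↦ by
  have h := modelDeriv_comp (E := E) (f := fun y ↦ y * u) (g := fun y ↦ y * a) (1 : G)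
    (mdifferentiableAt_rightTranslation _ _) (mdifferentiableAt_rightTranslation _ _)
  have h' : ((fun y ↦ y * a) ∘ fun y ↦ y * u) = (fun y : G ↦ y * (u * a)) := by ext; simp [mul_assoc]
  rw [h'] at h
  simp only [one_mul] at h
  exact (DFunLike.congr_fun h ξ).symm

end Trivialization

/-! ### Left-invariant and right-invariant vector fields commute -/

section Commute

open VectorField

variable {E : Type*} [NormedAddCommGroup E] [NormedSpace ℝ E]
  {G : Type*} [TopologicalSpace G] [ChartedSpace E G]

/-- The expression of a vector field in the canonical chart at `x`. -/
def chartField (V : VField E G) (x : G) : E → E :=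
  mpullbackWithin 𝓘(ℝ, E) 𝓘(ℝ, E) (extChartAt 𝓘(ℝ, E) x).symm V (Set.range 𝓘(ℝ, E))

lemma chartField_eq [IsManifold 𝓘(ℝ, E) ∞ G] (V : VField E G) (x : G) {y : E}
    (hy : y ∈ (extChartAt 𝓘(ℝ, E) x).target) :
    chartField V x y =
      mfderiv 𝓘(ℝ, E) 𝓘(ℝ, E) (extChartAt 𝓘(ℝ, E) x) ((extChartAt 𝓘(ℝ, E) x).symm y)
        (V ((extChartAt 𝓘(ℝ, E) x).symm y)) := by
  have : IsManifold 𝓘(ℝ, E) 1 G := IsManifold.of_le (n := ∞) (by simp)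
  exact DFunLike.congr_fun (ContinuousLinearMap.inverse_eq
    (mfderivWithin_extChartAt_symm_comp_mfderiv_extChartAt hy)
    (mfderiv_extChartAt_comp_mfderivWithin_extChartAt_symm hy)) _

lemma chartField_self [IsManifold 𝓘(ℝ, E) ∞ G] (V : VField E G) (x : G) :
    chartField V x (extChartAt 𝓘(ℝ, E) x x) = V x := by
  have : IsManifold 𝓘(ℝ, E) 1 G := IsManifold.of_le (n := ∞) (by simp)
  have h : ∀ z : G, z = x →
      (mfderiv 𝓘(ℝ, E) 𝓘(ℝ, E) (extChartAt 𝓘(ℝ, E) x) z (V z) : E) = V x := by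
    rintro z rfl
    rw [mfderiv_extChartAt_self]
    rfl
  rw [chartField_eq V x (mem_extChartAt_target x)]
  exact h _ (extChartAt_to_inv x)

/-- The tangent space at `x` is modelled on `E` through the chart at `x` itself, so that chart has
derivative the identity there. -/
lemma hasMFDerivAt_extChartAt_symm_self [IsManifold 𝓘(ℝ, E) ∞ G] (x : G) :
    HasMFDerivAt 𝓘(ℝ, E) 𝓘(ℝ, E) (extChartAt 𝓘(ℝ, E) x).symm (extChartAt 𝓘(ℝ, E) x x)
      (ContinuousLinearMap.id ℝ E) := by
  have : IsManifold 𝓘(ℝ, E) 1 G := IsManifold.of_le (n := ∞) (by simp)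
  have h1 := mdifferentiableWithinAt_extChartAt_symm (I := 𝓘(ℝ, E))
    (mem_extChartAt_target (I := 𝓘(ℝ, E)) x)
  have h2 := h1.hasMFDerivWithinAt
  rw [mfderivWithin_range_extChartAt_symm] at h2
  simp only [modelWithCornersSelf_coe, Set.range_id] at h2
  exact hasMFDerivWithinAt_univ.1 h2

variable [Group G]

variable (E G) in
/-- The multiplication of `G` in the canonical chart at `1`. -/
def chartMul (p : E × E) : E :=
  extChartAt 𝓘(ℝ, E) (1 : G)
    ((extChartAt 𝓘(ℝ, E) (1 : G)).symm p.1 * (extChartAt 𝓘(ℝ, E) (1 : G)).symm p.2)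

variable [LieGroup 𝓘(ℝ, E) ∞ G]

lemma contDiffAt_chartMul :
    ContDiffAt ℝ ∞ (chartMul E G)
      (extChartAt 𝓘(ℝ, E) (1 : G) 1, extChartAt 𝓘(ℝ, E) (1 : G) 1) := by
  set φ := extChartAt 𝓘(ℝ, E) (1 : G) with hφ
  have h1 : ContMDiffAt 𝓘(ℝ, E) 𝓘(ℝ, E) ∞ φ.symm (φ 1) :=
    (contMDiffOn_extChartAt_symm (1 : G)).contMDiffAt (extChartAt_target_mem_nhds (1 : G))
  have h2 : ContMDiffAt 𝓘(ℝ, E × E) 𝓘(ℝ, E) ∞ (fun p : E × E ↦ φ.symm p.1) (φ 1, φ 1) :=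
    ContMDiffAt.comp (φ 1, φ 1) (g := φ.symm) (f := Prod.fst) h1
      contDiff_fst.contMDiff.contMDiffAt
  have h3 : ContMDiffAt 𝓘(ℝ, E × E) 𝓘(ℝ, E) ∞ (fun p : E × E ↦ φ.symm p.2) (φ 1, φ 1) :=
    ContMDiffAt.comp (φ 1, φ 1) (g := φ.symm) (f := Prod.snd) h1
      contDiff_snd.contMDiff.contMDiffAt
  have h4 : ContMDiffAt 𝓘(ℝ, E) 𝓘(ℝ, E) ∞ φ (φ.symm (φ 1) * φ.symm (φ 1)) := by
    rw [hφ, extChartAt_to_inv, mul_one]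
    exact contMDiffAt_extChartAt
  have h5 : ContMDiffAt 𝓘(ℝ, E × E) 𝓘(ℝ, E) ∞ (chartMul E G) (φ 1, φ 1) :=
    ContMDiffAt.comp (φ 1, φ 1) (g := φ) (f := fun p : E × E ↦ φ.symm p.1 * φ.symm p.2) h4
      (h2.mul h3)
  exact h5.contDiffAt

/-- In the chart at `1`, left-invariant fields are partial derivatives of the multiplication in its
second variable, and right-invariant fields in its first. This reduces their bracket to second
derivatives. -/
lemma fderiv_chartMul_right (ξ : E) {y : E} (hy : y ∈ (extChartAt 𝓘(ℝ, E) (1 : G)).target)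
    (hd : DifferentiableAt ℝ (chartMul E G) (y, extChartAt 𝓘(ℝ, E) (1 : G) 1)) :
    fderiv ℝ (chartMul E G) (y, extChartAt 𝓘(ℝ, E) (1 : G) 1) (0, ξ) =
      chartField (leftField G ξ) 1 y := by
  rw [chartField_eq _ _ hy]
  set φ := extChartAt 𝓘(ℝ, E) (1 : G) with hφ
  have h1 : HasMFDerivAt 𝓘(ℝ, E) 𝓘(ℝ, E) (fun z : G ↦ φ.symm y * z) (φ.symm (φ 1)) (leftD E (φ.symm y)) := by
    rw [hφ, extChartAt_to_inv, ← hφ]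
    exact (mdifferentiableAt_leftTranslation _ _).hasMFDerivAt
  have h2 : HasMFDerivAt 𝓘(ℝ, E) 𝓘(ℝ, E) φ (φ.symm y * φ.symm (φ 1))
      (mfderiv 𝓘(ℝ, E) 𝓘(ℝ, E) φ (φ.symm y)) := by
    rw [hφ, extChartAt_to_inv, ← hφ, mul_one]
    have : φ.symm y ∈ (chartAt E (1 : G)).source := by
      rw [← extChartAt_source 𝓘(ℝ, E)]
      exact φ.map_target hy
    exact (mdifferentiableAt_extChartAt this).hasMFDerivAt
  have h3 := (h2.comp (φ.symm (φ 1)) h1).comp (φ 1) (hasMFDerivAt_extChartAt_symm_self (1 : G))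
  have h4 := hasMFDerivAt_iff_hasFDerivAt.1 h3
  have h5 : HasFDerivAt (fun z ↦ chartMul E G (y, z))
      ((fderiv ℝ (chartMul E G) (y, φ 1)) ∘L (ContinuousLinearMap.inr ℝ E E)) (φ 1) :=
    hd.hasFDerivAt.comp (φ 1) (hasFDerivAt_prodMk_right y (φ 1))
  exact DFunLike.congr_fun (h5.unique h4) ξ

lemma fderiv_chartMul_left (ξ : E) {y : E} (hy : y ∈ (extChartAt 𝓘(ℝ, E) (1 : G)).target)
    (hd : DifferentiableAt ℝ (chartMul E G) (extChartAt 𝓘(ℝ, E) (1 : G) 1, y)) :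
    fderiv ℝ (chartMul E G) (extChartAt 𝓘(ℝ, E) (1 : G) 1, y) (ξ, 0) =
      chartField (rightField G ξ) 1 y := by
  rw [chartField_eq _ _ hy]
  set φ := extChartAt 𝓘(ℝ, E) (1 : G) with hφ
  have h1 : HasMFDerivAt 𝓘(ℝ, E) 𝓘(ℝ, E) (fun z : G ↦ z * φ.symm y) (φ.symm (φ 1)) (modelDeriv E (fun z ↦ z * φ.symm y) 1) := by
    rw [hφ, extChartAt_to_inv, ← hφ]
    exact (mdifferentiableAt_rightTranslation _ _).hasMFDerivAt
  have h2 : HasMFDerivAt 𝓘(ℝ, E) 𝓘(ℝ, E) φ (φ.symm (φ 1) * φ.symm y)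
      (mfderiv 𝓘(ℝ, E) 𝓘(ℝ, E) φ (φ.symm y)) := by
    rw [hφ, extChartAt_to_inv, ← hφ, one_mul]
    have : φ.symm y ∈ (chartAt E (1 : G)).source := by
      rw [← extChartAt_source 𝓘(ℝ, E)]
      exact φ.map_target hy
    exact (mdifferentiableAt_extChartAt this).hasMFDerivAt
  have h3 := (h2.comp (φ.symm (φ 1)) h1).comp (φ 1) (hasMFDerivAt_extChartAt_symm_self (1 : G))
  have h4 := hasMFDerivAt_iff_hasFDerivAt.1 h3
  have h5 : HasFDerivAt (fun z ↦ chartMul E G (z, y))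
      ((fderiv ℝ (chartMul E G) (φ 1, y)) ∘L (ContinuousLinearMap.inl ℝ E E)) (φ 1) :=
    HasFDerivAt.comp (g := chartMul E G) (f := fun z ↦ (z, y)) (φ 1) hd.hasFDerivAt
      (hasFDerivAt_prodMk_left (φ 1) y)
  exact DFunLike.congr_fun (h5.unique h4) ξ

/-- In the chart the bracket at `1` is the difference of the two mixed second derivatives of the
multiplication, which agree by symmetry. -/
lemma mlieBracket_rightField_leftField_one (ξ η : E) :
    mlieBracket 𝓘(ℝ, E) (rightField G ξ) (leftField G η) 1 = 0 := by
  rw [← mlieBracketWithin_univ, mlieBracketWithin_apply]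
  refine (congrArg _ ?_).trans (map_zero _)
  change lieBracketWithin ℝ (chartField (rightField G ξ) 1) (chartField (leftField G η) 1) _ _ =
    (0 : E)
  have hu : (extChartAt 𝓘(ℝ, E) (1 : G)).symm ⁻¹' Set.univ ∩ Set.range 𝓘(ℝ, E) = Set.univ := by
    simp
  rw [hu, lieBracketWithin_univ]
  set x₀ : E := extChartAt 𝓘(ℝ, E) (1 : G) 1 with hx₀
  have hsm : ContDiffAt ℝ ∞ (chartMul E G) (x₀, x₀) := contDiffAt_chartMul
  have hev : ∀ᶠ p in 𝓝 (x₀, x₀), DifferentiableAt ℝ (chartMul E G) p := by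
    filter_upwards [(hsm.of_le (m := 1) (by simp)).eventually (by simp)] with p hp
    exact hp.differentiableAt (by simp)
  have htar : ∀ᶠ y in 𝓝 x₀, y ∈ (extChartAt 𝓘(ℝ, E) (1 : G)).target :=
    extChartAt_target_mem_nhds (1 : G)
  have c1 : ContinuousAt (fun y : E ↦ (y, x₀)) x₀ := by fun_prop
  have c2 : ContinuousAt (fun y : E ↦ (x₀, y)) x₀ := by fun_prop
  have hR : chartField (rightField G ξ) 1 =ᶠ[𝓝 x₀] fun y ↦ fderiv ℝ (chartMul E G) (x₀, y) (ξ, 0) := by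
    filter_upwards [htar, c2.eventually hev] with y hy hy'
    exact (fderiv_chartMul_left ξ hy hy').symm
  have hL : chartField (leftField G η) 1 =ᶠ[𝓝 x₀] fun y ↦ fderiv ℝ (chartMul E G) (y, x₀) (0, η) := by
    filter_upwards [htar, c1.eventually hev] with y hy hy'
    exact (fderiv_chartMul_right η hy hy').symm
  have hone : ∀ (V : VField E G) (v : E), V 1 = v →
      chartField V 1 x₀ = v := by
    rintro V _ rfl
    exact chartField_self V 1
  have hd : DifferentiableAt ℝ (fderiv ℝ (chartMul E G)) (x₀, x₀) :=
    ((hsm.fderiv_right (m := 1) (WithTop.coe_le_coe.2 le_top)).differentiableAt (by simp))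
  have dR : fderiv ℝ (fun y ↦ fderiv ℝ (chartMul E G) (x₀, y) (ξ, 0)) x₀ η =
      fderiv ℝ (fderiv ℝ (chartMul E G)) (x₀, x₀) (0, η) (ξ, 0) := by
    have h1 := hd.hasFDerivAt.comp x₀ (hasFDerivAt_prodMk_right x₀ x₀)
    have h2 := h1.clm_apply (hasFDerivAt_const ((ξ, 0) : E × E) x₀)
    exact (DFunLike.congr_fun h2.fderiv η).trans (by simp)
  have dL : fderiv ℝ (fun y ↦ fderiv ℝ (chartMul E G) (y, x₀) (0, η)) x₀ ξ =
      fderiv ℝ (fderiv ℝ (chartMul E G)) (x₀, x₀) (ξ, 0) (0, η) := by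
    have h1 := HasFDerivAt.comp (g := fderiv ℝ (chartMul E G)) (f := fun y ↦ (y, x₀)) x₀
      hd.hasFDerivAt (hasFDerivAt_prodMk_left x₀ x₀)
    have h2 := h1.clm_apply (hasFDerivAt_const ((0, η) : E × E) x₀)
    exact (DFunLike.congr_fun h2.fderiv ξ).trans (by simp)
  have hsymm : IsSymmSndFDerivAt ℝ (chartMul E G) (x₀, x₀) :=
    hsm.isSymmSndFDerivAt (by
      rw [minSmoothness_of_isRCLikeNormedField]
      exact WithTop.coe_le_coe.2 le_top)
  rw [hR.lieBracket_vectorField_eq hL, lieBracket_eq]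
  have e1 := hone _ _ (rightField_one ξ)
  have e2 := hone _ _ (leftField_one η)
  rw [hR.self_of_nhds] at e1
  rw [hL.self_of_nhds] at e2
  simp only [e1, e2]
  rw [dR, dL, hsymm]
  exact sub_self _

end Commute

/-! ### Covariant derivatives in the left-invariant frame -/

section Connection

open VectorField

variable {E : Type*} [NormedAddCommGroup E] [NormedSpace ℝ E]
  {G : Type*} [TopologicalSpace G] [ChartedSpace E G]

lemma cov_sum [IsManifold 𝓘(ℝ, E) ∞ G]
    (cov : CovariantDerivative 𝓘(ℝ, E) E (fun x : G ↦ TangentSpace 𝓘(ℝ, E) x))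
    {κ : Type*} (s : Finset κ) (X : κ → VField E G) (x : G) (hX : ∀ i, DiffVFieldAt (X i) x) :
    DiffVFieldAt (∑ i ∈ s, X i) x ∧ cov (∑ i ∈ s, X i) x = ∑ i ∈ s, cov (X i) x := by
  classical
  induction s using Finset.induction_on with
  | empty =>
    refine ⟨mdifferentiableAt_zeroSection .., ?_⟩
    simp
  | insert a s ha ih =>
    rw [Finset.sum_insert ha, Finset.sum_insert ha]
    refine ⟨mdifferentiableAt_add_section (hX a) ih.1, ?_⟩
    rw [← ih.2]
    exact cov.isCovariantDerivativeOnUniv.add (hX a) ih.1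

variable [Group G]

lemma leftField_sum_smul {κ : Type*} (s : Finset κ) (c : κ → ℝ) (ξ : κ → E) (u : G) :
    leftField G (∑ i ∈ s, c i • ξ i) u = ∑ i ∈ s, c i • leftField G (ξ i) u := by
  have h : leftD E u (∑ i ∈ s, c i • ξ i) = ∑ i ∈ s, c i • leftD E u (ξ i) := by simp
  exact h

variable [LieGroup 𝓘(ℝ, E) ∞ G]

lemma diffVFieldAt_leftField (ξ : E) (x : G) : DiffVFieldAt (leftField G ξ) x :=
  (contMDiff_leftField ξ).contMDiffAt.mdifferentiableAt (by simp)

lemma diffVFieldAt_rightField (ξ : E) (x : G) : DiffVFieldAt (rightField G ξ) x :=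
  (contMDiff_rightField ξ).contMDiffAt.mdifferentiableAt (by simp)

/-- The covariant derivative of a vector field in terms of its expression in the left
trivialization. -/
lemma cov_eq_leftCoord [FiniteDimensional ℝ E]
    (cov : CovariantDerivative 𝓘(ℝ, E) E (fun x : G ↦ TangentSpace 𝓘(ℝ, E) x))
    {X : VField E G} {x : G} (hX : DiffVFieldAt X x) (v : TangentSpace 𝓘(ℝ, E) x) :
    cov X x v = leftField G (mvfderiv 𝓘(ℝ, E) (leftCoord X) x v) x +
      cov (leftField G (leftCoord X x)) x v := by
  let b := Module.finBasis ℝ E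
  let f : Fin (Module.finrank ℝ E) → G → ℝ := fun j u ↦ b.coord j (leftCoord X u)
  have hc := mdifferentiableAt_leftCoord hX
  have hf : ∀ j, HasMFDerivAt 𝓘(ℝ, E) 𝓘(ℝ, ℝ) (f j) x
      ((b.coord j).toContinuousLinearMap ∘L mvfderiv 𝓘(ℝ, E) (leftCoord X) x) := fun j ↦
    ((b.coord j).toContinuousLinearMap.hasMFDerivAt (x := leftCoord X x)).comp x hc.hasMFDerivAt
  have hf' : ∀ j, mvfderiv 𝓘(ℝ, E) (f j) x v =
      b.coord j (mvfderiv 𝓘(ℝ, E) (leftCoord X) x v) := fun j ↦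
    DFunLike.congr_fun (hf j).mfderiv v
  have hXsum : X = ∑ j, f j • leftField G (b j) := by
    funext u
    rw [← leftField_leftCoord X u, Finset.sum_apply]
    conv_lhs => rw [← b.sum_repr (leftCoord X u)]
    exact leftField_sum_smul _ _ _ _
  have h1 : ∀ j, DiffVFieldAt (f j • leftField G (b j)) x := fun j ↦
    (hf j).mdifferentiableAt.smul_section (diffVFieldAt_leftField (b j) x)
  have h2 : ∀ j, DiffVFieldAt (f j x • leftField G (b j)) x := fun j ↦
    (diffVFieldAt_leftField (b j) x).smul_const_section
  have h3 : leftField G (leftCoord X x) = ∑ j, f j x • leftField G (b j) := by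
    funext u
    rw [Finset.sum_apply]
    conv_lhs => rw [← b.sum_repr (leftCoord X x)]
    exact leftField_sum_smul _ _ _ _
  -- The field `X` is compared with the left-invariant field whose frame coefficients are frozen at
  -- their value at `x`; the two covariant derivatives differ by the Leibniz terms in the
  -- derivatives of the coefficients.
  have h4 : cov X x v = ∑ j, cov (f j • leftField G (b j)) x v := by
    conv_lhs => rw [hXsum]
    rw [(cov_sum cov _ _ x h1).2]
    simp
  have h5 : cov (leftField G (leftCoord X x)) x v = ∑ j, cov (f j x • leftField G (b j)) x v := by
    rw [h3, (cov_sum cov _ _ x h2).2]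
    simp
  have h6 : leftField G (mvfderiv 𝓘(ℝ, E) (leftCoord X) x v) x =
      ∑ j, mvfderiv 𝓘(ℝ, E) (f j) x v • leftField G (b j) x := by
    simp only [hf']
    conv_lhs => rw [← b.sum_repr (mvfderiv 𝓘(ℝ, E) (leftCoord X) x v)]
    exact leftField_sum_smul _ _ _ _
  rw [h4, h5, h6, ← Finset.sum_add_distrib]
  refine Finset.sum_congr rfl fun j _ ↦ ?_
  rw [cov.isCovariantDerivativeOnUniv.leibniz (diffVFieldAt_leftField (b j) x)
    (hf j).mdifferentiableAt, cov.isCovariantDerivativeOnUniv.smul_const _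
    (diffVFieldAt_leftField (b j) x)]
  simp [add_comm]

end Connection

/-! ### Covariant derivatives of symmetric tensors in the left-invariant frame -/

section SymCov

variable {E : Type*} [NormedAddCommGroup E] [NormedSpace ℝ E]
  {G : Type*} [TopologicalSpace G] [ChartedSpace E G] [Group G]

/-- The left-invariant linear form with value `β` at the identity. -/
def leftForm (β : E →ₗ[ℝ] ℝ) (u : G) : TangentSpace 𝓘(ℝ, E) u →ₗ[ℝ] ℝ :=
  β ∘ₗ (leftDInv E u).toLinearMap

lemma leftForm_apply (β : E →ₗ[ℝ] ℝ) (X : VField E G) (u : G) :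
    leftForm β u (X u) = β (leftCoord X u) := rfl

lemma SymField.IsLeftInvariant.symMap_leftD {K : SymField E G} (hK : K.IsLeftInvariant) (u : G) :
    symMap (W := TangentSpace 𝓘(ℝ, E) u) (leftD E u).toLinearMap (K 1) = K u := by
  -- The fibres over `u * 1` and `u` are both the model space by definition. Stating the equality
  -- for a variable base point permits substitution without a dependent rewrite; the same device
  -- recurs below.
  have h : ∀ b, b = u → (K b : SymmetricAlgebra ℝ E) = K u := by
    rintro _ rfl
    rfl
  exact (hK u 1).trans (h _ (mul_one u))

variable [LieGroup 𝓘(ℝ, E) ∞ G]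

lemma leftForm_comp_leftD (β : E →ₗ[ℝ] ℝ) (u : G) :
    (leftForm β u : E →ₗ[ℝ] ℝ) ∘ₗ (leftD E u).toLinearMap = β := by
  ext w
  exact congrArg β (DFunLike.congr_fun (leftDInv_comp_leftD (E := E) u) w)

lemma SymField.IsLeftInvariant.symEval_leftForm {K : SymField E G} (hK : K.IsLeftInvariant)
    (β : E →ₗ[ℝ] ℝ) (u : G) : symEval (leftForm β u) (K u) = symEval (V := E) β (K 1) := by
  rw [← hK.symMap_leftD u]
  refine (symEval_symMap _ _ _).trans ?_
  exact congrArg (fun γ : E →ₗ[ℝ] ℝ ↦ symEval γ (K 1)) (leftForm_comp_leftD β u)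

/-- The connection form in the left-invariant frame. -/
def leftConnection (cov : CovariantDerivative 𝓘(ℝ, E) E (fun x : G ↦ TangentSpace 𝓘(ℝ, E) x))
    (x : G) (v : TangentSpace 𝓘(ℝ, E) x) :
    TangentSpace 𝓘(ℝ, E) x →ₗ[ℝ] TangentSpace 𝓘(ℝ, E) x where
  toFun w := cov (leftField G (leftDInv E x w)) x v
  map_add' w w' := by
    have h : leftField G (leftDInv E x (w + w')) =
        leftField G (leftDInv E x w) + leftField G (leftDInv E x w') := by
      funext u
      have : ∀ a b : E, leftD E u (leftDInv E x (a + b)) =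
          leftD E u (leftDInv E x a) + leftD E u (leftDInv E x b) := fun a b ↦ by
        rw [map_add, map_add]
      exact this w w'
    rw [h, cov.isCovariantDerivativeOnUniv.add (diffVFieldAt_leftField _ x)
      (diffVFieldAt_leftField _ x)]
    simp
  map_smul' c w := by
    have h : leftField G (leftDInv E x (c • w)) = c • leftField G (leftDInv E x w) := by
      funext u
      have : ∀ a : E, leftD E u (leftDInv E x (c • a)) = c • leftD E u (leftDInv E x a) :=
        fun a ↦ by rw [map_smul, map_smul]
      exact this w
    rw [h, cov.isCovariantDerivativeOnUniv.smul_const _ (diffVFieldAt_leftField _ x)]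
    simp

variable [FiniteDimensional ℝ E]

/-- The covariant derivative of a symmetric tensor in terms of its values on left-invariant linear
forms. -/
lemma HasSymCovDerivAt.symEval_leftForm
    {cov : CovariantDerivative 𝓘(ℝ, E) E (fun x : G ↦ TangentSpace 𝓘(ℝ, E) x)} {x : G}
    {K : SymField E G}
    {D : TangentSpace 𝓘(ℝ, E) x → SymmetricAlgebra ℝ (TangentSpace 𝓘(ℝ, E) x)}
    (h : HasSymCovDerivAt cov x K D) (β : E →ₗ[ℝ] ℝ) :
    MDifferentiableAt 𝓘(ℝ, E) 𝓘(ℝ, ℝ) (fun u ↦ symEval (leftForm β u) (K u)) x ∧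
      ∀ v, symEval (leftForm β x) (D v) =
        mvfderiv 𝓘(ℝ, E) (fun u ↦ symEval (leftForm β u) (K u)) x v +
          symDeriv (leftForm β x) (leftForm β x ∘ₗ leftConnection cov x v) (K x) := by
  -- Both sides follow the additive and Leibniz rules, so it suffices to treat functions and vector
  -- fields. As the right side involves only `K`, the formula also shows that `D` does not depend on
  -- how `K` is presented.
  induction h with
  | ofFun f hf =>
    have h1 : (fun u ↦ symEval (leftForm β u) (SymField.ofFun E f u)) = f := by
      funext u
      simp [SymField.ofFun]
    rw [h1]
    refine ⟨hf, fun v ↦ ?_⟩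
    rw [SymField.ofFun, symDeriv_algebraMap]
    simp
  | ofVField X hX =>
    have h1 : (fun u ↦ symEval (leftForm β u) (SymField.ofVField X u)) =
        fun u ↦ β (leftCoord X u) := by
      funext u
      rw [SymField.ofVField, symEval_ι, leftForm_apply]
    have h2 : HasMFDerivAt 𝓘(ℝ, E) 𝓘(ℝ, ℝ) (fun u ↦ β (leftCoord X u)) x
        (β.toContinuousLinearMap ∘L mvfderiv 𝓘(ℝ, E) (leftCoord X) x) :=
      (β.toContinuousLinearMap.hasMFDerivAt (x := leftCoord X x)).comp x
        (mdifferentiableAt_leftCoord hX).hasMFDerivAt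
    rw [h1]
    refine ⟨h2.mdifferentiableAt, fun v ↦ ?_⟩
    have h3 : mvfderiv 𝓘(ℝ, E) (fun u ↦ β (leftCoord X u)) x v =
        β (mvfderiv 𝓘(ℝ, E) (leftCoord X) x v) := DFunLike.congr_fun h2.mfderiv v
    have h4 : leftForm β x (leftField G (mvfderiv 𝓘(ℝ, E) (leftCoord X) x v) x) =
        β (mvfderiv 𝓘(ℝ, E) (leftCoord X) x v) := by
      rw [leftForm_apply, leftCoord_leftField]
    rw [symEval_ι, cov_eq_leftCoord cov hX, map_add, h3, h4, SymField.ofVField, symDeriv_ι]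
    rfl
  | add _ _ h h' =>
    refine ⟨?_, fun v ↦ ?_⟩
    · simp only [Pi.add_apply, map_add]
      exact h.1.add h'.1
    · simp only [Pi.add_apply, map_add, symDeriv_add]
      rw [mvfderiv_fun_add h.1 h'.1, h.2, h'.2]
      simp only [add_apply]
      ring
  | mul _ _ h h' =>
    refine ⟨?_, fun v ↦ ?_⟩
    · simp only [Pi.mul_apply, map_mul]
      exact h.1.mul h'.1
    · simp only [Pi.mul_apply, map_add, map_mul, symDeriv_mul]
      rw [mvfderiv_fun_mul h.1 h'.1, h.2, h'.2]
      simp only [add_apply, smul_apply, smul_eq_mul]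
      ring
  | @congr K K' D _ hK h =>
    have h1 : (fun u ↦ symEval (leftForm β u) (K' u)) =ᶠ[𝓝 x]
        fun u ↦ symEval (leftForm β u) (K u) := by
      filter_upwards [hK] with u hu
      rw [hu]
    refine ⟨h.1.congr_of_eventuallyEq h1, fun v ↦ ?_⟩
    rw [h.2, hK.self_of_nhds]
    congr 1
    exact (DFunLike.congr_fun h1.mfderiv_eq v).symm

end SymCov

/-! ### The Levi-Civita connection of a left-invariant metric -/

section LeviCivita

open VectorField

variable {E : Type*} [NormedAddCommGroup E] [NormedSpace ℝ E] [FiniteDimensional ℝ E]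
  {G : Type*} [TopologicalSpace G] [ChartedSpace E G] [Group G] [LieGroup 𝓘(ℝ, E) ∞ G]

variable (G) in
/-- The Lie bracket of left-invariant vector fields, on the model space. -/
def modelBracket (ξ η : E) : E := mlieBracket 𝓘(ℝ, E) (leftField G ξ) (leftField G η) 1

lemma modelBracket_swap (ξ η : E) : modelBracket G ξ η = -modelBracket G η ξ :=
  mlieBracket_swap_apply

lemma mlieBracket_leftField (ξ η : E) (u : G) :
    mlieBracket 𝓘(ℝ, E) (leftField G ξ) (leftField G η) u = leftField G (modelBracket G ξ η) u :=
  (congrFun (mulInvariantVector_mlieBracket (I := 𝓘(ℝ, E)) (G := G) ξ η) u).symm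

/-! ### Derivatives of the adjoint action, and functions with zero derivative -/

section Torsion

variable {cov : CovariantDerivative 𝓘(ℝ, E) E (fun x : G ↦ TangentSpace 𝓘(ℝ, E) x)}

lemma cov_leftField_sub (hcov : cov.torsion = 0) (ξ η : E) (u : G) :
    cov (leftField G η) u (leftField G ξ u) - cov (leftField G ξ) u (leftField G η u) =
      leftField G (modelBracket G ξ η) u := by
  rw [← mlieBracket_leftField]
  exact cov.torsion_eq_zero_iff.1 hcov (diffVFieldAt_leftField ξ u) (diffVFieldAt_leftField η u)

lemma mdifferentiableAt_adInv (ξ : E) (u : G) :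
    MDifferentiableAt 𝓘(ℝ, E) 𝓘(ℝ, E) (fun u : G ↦ adInv E u ξ) u :=
  mdifferentiableAt_leftCoord (diffVFieldAt_rightField ξ u)

/-- The left coordinate of the right-invariant field of `ξ` is `adInv u ξ`. Absence of torsion
expresses the brackets of the left-invariant field of `η` with the right- and left-invariant fields
of `ξ` through covariant derivatives. The first bracket vanishes, the second is `modelBracket G ξ
η`, and `cov_eq_leftCoord` identifies the difference with the derivative sought. -/
lemma mvfderiv_adInv_one (hcov : cov.torsion = 0) (ξ η : E) :
    mvfderiv 𝓘(ℝ, E) (fun u : G ↦ adInv E u ξ) 1 η = modelBracket G ξ η := by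
  have h1 := (cov.torsion_eq_zero_iff.1 hcov (diffVFieldAt_rightField ξ 1)
    (diffVFieldAt_leftField η 1)).trans (mlieBracket_rightField_leftField_one (G := G) ξ η)
  have h2 := cov_leftField_sub hcov ξ η (1 : G)
  have h3 := cov_eq_leftCoord cov (diffVFieldAt_rightField (G := G) ξ 1) η
  have h4 : leftCoord (rightField G ξ) 1 = ξ := by
    rw [leftCoord_rightField, adInv_one]
    rfl
  rw [rightField_one, leftField_one] at h1
  rw [leftField_one, leftField_one, leftField_one] at h2
  rw [h4, leftField_one] at h3
  have key : ∀ p q r d b : E, p - q = 0 → p - r = b → q = d + r → d = b := by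
    rintro p q r d b h rfl rfl
    rw [sub_eq_zero.1 h]
    abel
  exact key _ _ _ _ _ h1 h2 h3

lemma mvfderiv_adInv (hcov : cov.torsion = 0) (ξ η : E) (u : G) :
    mvfderiv 𝓘(ℝ, E) (fun u : G ↦ adInv E u ξ) u (leftField G η u) =
      modelBracket G (adInv E u ξ) η := by
  refine Eq.trans ?_ (mvfderiv_adInv_one (G := G) hcov (adInv E u ξ) η)
  have h1 : (fun y : G ↦ adInv E y (adInv E u ξ)) = (fun y ↦ adInv E y ξ) ∘ (fun y ↦ u * y) := by
    funext y
    simp only [Function.comp_apply, adInv_mul]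
    rfl
  have h2 : ∀ b : G, b = u → ∀ v : E,
      (mfderiv 𝓘(ℝ, E) 𝓘(ℝ, E) (fun y : G ↦ adInv E y ξ) u : E → E) v =
      (mfderiv 𝓘(ℝ, E) 𝓘(ℝ, E) (fun y : G ↦ adInv E y ξ) b : E → E) v := by
    rintro _ rfl _
    rfl
  rw [h1]
  exact (h2 _ (mul_one u) _).trans (DFunLike.congr_fun
    (mfderiv_comp_of_eq (I := 𝓘(ℝ, E)) (I' := 𝓘(ℝ, E)) (I'' := 𝓘(ℝ, E))
      (f := fun y : G ↦ u * y) (x := 1) (mdifferentiableAt_adInv (E := E) ξ u)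
      (mdifferentiableAt_leftTranslation u 1) (mul_one u)) η).symm

lemma hasMFDerivAt_clm_comp {f : G → E} {u : G} (hf : MDifferentiableAt 𝓘(ℝ, E) 𝓘(ℝ, E) f u)
    {F : Type*} [NormedAddCommGroup F] [NormedSpace ℝ F] (A : E →L[ℝ] F) :
    HasMFDerivAt 𝓘(ℝ, E) 𝓘(ℝ, F) (fun y ↦ A (f y)) u (A ∘L mvfderiv 𝓘(ℝ, E) f u) :=
  (A.hasMFDerivAt (x := f u)).comp u hf.hasMFDerivAt

lemma mvfderiv_adInv_rightField (hcov : cov.torsion = 0) (ξ η : E) (u : G) :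
    mvfderiv 𝓘(ℝ, E) (fun u : G ↦ adInv E u ξ) u (rightField G η u) =
      adInv E u (modelBracket G ξ η) := by
  have h1 : (fun y : G ↦ adInv E u (adInv E y ξ)) = (fun y ↦ adInv E y ξ) ∘ (fun y ↦ y * u) := by
    funext y
    simp only [Function.comp_apply, adInv_mul]
    rfl
  have h2 : ∀ b : G, b = u → ∀ v : E,
      (mfderiv 𝓘(ℝ, E) 𝓘(ℝ, E) (fun y : G ↦ adInv E y ξ) u : E → E) v =
      (mfderiv 𝓘(ℝ, E) 𝓘(ℝ, E) (fun y : G ↦ adInv E y ξ) b : E → E) v := by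
    rintro _ rfl _
    rfl
  have h3 := (hasMFDerivAt_clm_comp (mdifferentiableAt_adInv (G := G) ξ 1) (adInv E u)).mfderiv
  rw [h1] at h3
  rw [← mvfderiv_adInv_one (G := G) hcov ξ η]
  refine (h2 _ (one_mul u) _).trans ((DFunLike.congr_fun
    (mfderiv_comp_of_eq (I := 𝓘(ℝ, E)) (I' := 𝓘(ℝ, E)) (I'' := 𝓘(ℝ, E))
      (f := fun y : G ↦ y * u) (x := 1) (mdifferentiableAt_adInv (E := E) ξ u)
      (mdifferentiableAt_rightTranslation u 1) (one_mul u)) η).symm.trans ?_)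
  exact DFunLike.congr_fun h3 η

/-- Functions with vanishing derivative on a connected manifold are constant. -/
lemma eq_of_mfderiv_eq_zero {M : Type*} [TopologicalSpace M] [ChartedSpace E M]
    [IsManifold 𝓘(ℝ, E) ∞ M] [ConnectedSpace M] {f : M → ℝ}
    (hf : MDifferentiable 𝓘(ℝ, E) 𝓘(ℝ, ℝ) f) (h : ∀ x, mvfderiv 𝓘(ℝ, E) f x = 0) (x y : M) :
    f x = f y := by
  have hloc : IsLocallyConstant f := by
    rw [IsLocallyConstant.iff_eventually_eq]
    intro x
    set φ := extChartAt 𝓘(ℝ, E) x with hφ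
    obtain ⟨r, hr, hball⟩ := Metric.isOpen_iff.1 (isOpen_extChartAt_target (I := 𝓘(ℝ, E)) x) (φ x)
      (mem_extChartAt_target x)
    have hd : ∀ z ∈ Metric.ball (φ x) r, HasFDerivAt (f ∘ φ.symm) (0 : E →L[ℝ] ℝ) z := by
      intro z hz
      have h1 : MDifferentiableAt 𝓘(ℝ, E) 𝓘(ℝ, E) φ.symm z :=
        ((contMDiffOn_extChartAt_symm (n := 1) x).contMDiffAt
          ((isOpen_extChartAt_target x).mem_nhds (hball hz))).mdifferentiableAt (by simp)
      have h2 := (hf (φ.symm z)).hasMFDerivAt.comp z h1.hasMFDerivAt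
      have h3 := hasMFDerivAt_iff_hasFDerivAt.1 h2
      have h4 : mfderiv 𝓘(ℝ, E) 𝓘(ℝ, ℝ) f (φ.symm z) = 0 := h (φ.symm z)
      rw [h4] at h3
      refine h3.congr_fderiv ?_
      ext w
      rfl
    have hconst : ∀ z ∈ Metric.ball (φ x) r, f (φ.symm z) = f x := by
      intro z hz
      have := (convex_ball (φ x) r).is_const_of_fderivWithin_eq_zero (𝕜 := ℝ) (f := f ∘ φ.symm)
        (fun z hz ↦ (hd z hz).differentiableAt.differentiableWithinAt)
        (fun z hz ↦ by
          rw [fderivWithin_of_isOpen Metric.isOpen_ball hz]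
          exact (hd z hz).fderiv) hz (Metric.mem_ball_self hr)
      simpa [hφ] using this
    filter_upwards [(continuousAt_extChartAt (I := 𝓘(ℝ, E)) x).preimage_mem_nhds
      (Metric.ball_mem_nhds _ hr), extChartAt_source_mem_nhds (I := 𝓘(ℝ, E)) x] with y hy hy'
    have := hconst _ hy
    rwa [φ.left_inv hy'] at this
  exact hloc.apply_eq_of_isPreconnected isPreconnected_univ (Set.mem_univ _) (Set.mem_univ _)

end Torsion

section ModelInner

variable [RiemannianBundle (fun x : G ↦ TangentSpace 𝓘(ℝ, E) x)]

variable (E G) in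
/-- The inner product at the identity, on the model space. -/
def modelInner (v w : E) : ℝ := @inner ℝ (TangentSpace 𝓘(ℝ, E) (1 : G)) _ v w

lemma modelInner_neg_left (v w : E) : modelInner E G (-v) w = - modelInner E G v w :=
  inner_neg_left (E := TangentSpace 𝓘(ℝ, E) (1 : G)) v w

end ModelInner

/-! ### Koszul-type identities and Killing fields -/

section Metric

variable [RiemannianBundle (fun x : G ↦ TangentSpace 𝓘(ℝ, E) x)]
  [IsContMDiffRiemannianBundle 𝓘(ℝ, E) ∞ E (fun x : G ↦ TangentSpace 𝓘(ℝ, E) x)]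
  {cov : CovariantDerivative 𝓘(ℝ, E) E (fun x : G ↦ TangentSpace 𝓘(ℝ, E) x)}

lemma inner_leftField (hg : IsLeftInvariantMetric E G) (v w : E) (u : G) :
    inner ℝ (leftField G v u) (leftField G w u) = modelInner E G v w := by
  have h : ∀ b : G, b = u → ∀ v w : E,
      @inner ℝ (TangentSpace 𝓘(ℝ, E) b) _ v w = @inner ℝ (TangentSpace 𝓘(ℝ, E) u) _ v w := by
    rintro _ rfl _ _
    rfl
  exact (h _ (mul_one u) _ _).symm.trans (hg u 1 v w)

/-- Absence of torsion exchanges the two fields at the cost of the bracket. The exchanged term is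
half the derivative of the squared length of the left-invariant field of `a`, which is constant. -/
lemma inner_cov_leftField (hg : IsLeftInvariantMetric E G) (hcov : IsLeviCivita cov)
    (a w : E) (u : G) :
    inner ℝ (cov (leftField G w) u (leftField G a u)) (leftField G a u) =
      modelInner E G (modelBracket G a w) a := by
  have h1 := cov_leftField_sub hcov.torsionFree a w u
  have h2 := hcov.metric.mvfderiv_inner_eq (x := u) (leftField G w)
    (diffVFieldAt_leftField a u) (diffVFieldAt_leftField a u)
  have h3 : (fun u ↦ inner ℝ (leftField G a u) (leftField G a u)) =
      fun _ : G ↦ modelInner E G a a := by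
    funext u
    exact inner_leftField hg a a u
  have h4 : mvfderiv 𝓘(ℝ, E) (fun _ : G ↦ modelInner E G a a) u = 0 := mvfderiv_const _
  rw [h3, h4] at h2
  rw [sub_eq_iff_eq_add.1 h1, inner_add_left, inner_leftField hg]
  have h5 : (0 : ℝ) = inner ℝ (cov (leftField G a) u (leftField G w u)) (leftField G a u) +
    inner ℝ (leftField G a u) (cov (leftField G a) u (leftField G w u)) := h2
  rw [real_inner_comm (cov (leftField G a) u (leftField G w u)) (leftField G a u)] at h5
  linarith

/-- The derivative of the left coordinate and the connection term contribute opposite brackets. This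
is the Killing equation for right-invariant fields. -/
lemma inner_cov_rightField (hg : IsLeftInvariantMetric E G) (hcov : IsLeviCivita cov)
    (ξ a : E) (u : G) :
    inner ℝ (cov (rightField G ξ) u (leftField G a u)) (leftField G a u) = 0 := by
  have h1 : mvfderiv 𝓘(ℝ, E) (leftCoord (rightField G ξ)) u (leftField G a u) =
    modelBracket G (adInv E u ξ) a := mvfderiv_adInv hcov.torsionFree ξ a u
  rw [cov_eq_leftCoord cov (diffVFieldAt_rightField ξ u), inner_add_left, leftCoord_rightField,
    inner_cov_leftField hg hcov, h1, inner_leftField hg, modelBracket_swap, modelInner_neg_left,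
    neg_add_cancel]

/-- A vector field whose covariant derivative is skew-symmetric is a Killing vector field. -/
lemma isKillingVField_of_inner_eq_zero (hcov : IsLeviCivita cov) {X : VField E G}
    (hX : ∀ u, SmoothVFieldAt X u)
    (h : ∀ u (v : TangentSpace 𝓘(ℝ, E) u), inner ℝ (cov X u v) v = 0) : IsKillingVField X := by
  refine ⟨⟨fun u ↦ ⟨SymField.ofVField X, Algebra.subset_adjoin (Or.inr ⟨X, hX u, rfl⟩),
    Eventually.of_forall fun _ ↦ rfl⟩, fun u ↦ ?_⟩, cov, hcov, fun u ↦
      ⟨_, HasSymCovDerivAt.ofVField X ((hX u).mdifferentiableAt (by simp)), ?_⟩⟩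
  · rw [SymPower, pow_one]
    exact ⟨X u, rfl⟩
  · apply symEval_injective
    intro α
    obtain ⟨a, ha⟩ := (InnerProductSpace.toDual ℝ (TangentSpace 𝓘(ℝ, E) u)).surjective
      α.toContinuousLinearMap
    have hα : ∀ v, α v = inner ℝ a v := fun v ↦ by
      rw [← InnerProductSpace.toDual_apply_apply, ha]
      rfl
    rw [map_sum, map_zero]
    simp only [map_mul, symEval_ι, hα]
    have h1 : ∀ i, inner ℝ a (tangentONB E G u i) * inner ℝ a (cov X u (tangentONB E G u i)) =
        inner ℝ a (cov X u ((inner ℝ (tangentONB E G u i) a) • tangentONB E G u i)) := by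
      intro i
      rw [map_smul, inner_smul_right, real_inner_comm]
    rw [Finset.sum_congr rfl fun i _ ↦ h1 i, ← inner_sum, ← map_sum,
      OrthonormalBasis.sum_repr' (tangentONB E G u) a, real_inner_comm]
    exact h u a

end Metric

end LeviCivita

/-! ### Orthonormal frames adapted to an abelian ideal of codimension one -/

section AdaptedFrame

/-- The vector `e` spans the orthogonal line of the hyperplane `H`. The statement is about an
abstract inner product space because the metric lives on the tangent space at `1`, while the norm of
`E` is unrelated to it. -/
lemma exists_orthonormal_adapted {V : Type*} [NormedAddCommGroup V] [InnerProductSpace ℝ V]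
    [FiniteDimensional ℝ V] (H : Submodule ℝ V) (hH : Module.finrank ℝ (V ⧸ H) = 1) :
    ∃ (e : V) (w : Fin (Module.finrank ℝ H) → V), (∀ i, w i ∈ H) ∧ inner ℝ e e = 1 ∧
      (∀ x ∈ H, inner ℝ e x = 0) ∧ (∀ i j, inner ℝ (w i) (w j) = if i = j then 1 else 0) ∧
      ∀ x, x = inner ℝ e x • e + ∑ i, inner ℝ (w i) x • w i := by
  have h1 : Module.finrank ℝ Hᗮ = 1 := by
    have h2 := H.finrank_add_finrank_orthogonal
    have h3 := H.finrank_quotient_add_finrank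
    omega
  let b := stdOrthonormalBasis ℝ H
  let b' := (stdOrthonormalBasis ℝ Hᗮ).reindex (finCongr h1)
  have hb : ∀ i j, inner ℝ (b i : V) (b j : V) = if i = j then 1 else 0 := fun i j ↦ by
    rw [← Submodule.coe_inner]
    exact orthonormal_iff_ite.1 b.orthonormal i j
  have hb' : inner ℝ (b' 0 : V) (b' 0 : V) = 1 := by
    rw [← Submodule.coe_inner]
    simpa using orthonormal_iff_ite.1 b'.orthonormal 0 0
  have h0 : ∀ x ∈ H, inner ℝ (b' 0 : V) x = 0 := fun x hx ↦
    Submodule.inner_left_of_mem_orthogonal hx (b' 0).2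
  refine ⟨b' 0, fun i ↦ b i, fun i ↦ (b i).2, hb', h0, hb, fun x ↦ ?_⟩
  obtain ⟨y, hy, z, hz, rfl⟩ := H.exists_add_mem_mem_orthogonal x
  have hy' := congrArg (Subtype.val) (b.sum_repr' ⟨y, hy⟩)
  have hz' := congrArg (Subtype.val) (b'.sum_repr' ⟨z, hz⟩)
  simp only [Fin.sum_univ_one, Submodule.coe_inner, Submodule.coe_smul,
    Submodule.coe_sum] at hy' hz'
  have h5 : ∀ i, inner ℝ (b i : V) z = 0 := fun i ↦
    Submodule.inner_right_of_mem_orthogonal (b i).2 hz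
  simp only [inner_add_right, h0 y hy, zero_add, h5, add_zero]
  rw [hz', hy', add_comm]

variable {E : Type*} [NormedAddCommGroup E] [NormedSpace ℝ E] [FiniteDimensional ℝ E]
  {G : Type*} [TopologicalSpace G] [ChartedSpace E G] [Group G] [LieGroup 𝓘(ℝ, E) ∞ G]

lemma modelBracket_add_left (ξ ξ' η : E) :
    modelBracket G (ξ + ξ') η = modelBracket G ξ η + modelBracket G ξ' η :=
  add_lie (L := GroupLieAlgebra 𝓘(ℝ, E) G) (M := GroupLieAlgebra 𝓘(ℝ, E) G) ξ ξ' η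

lemma modelBracket_sum_smul_left {ι : Type*} (s : Finset ι) (c : ι → ℝ) (w : ι → E) (η : E) :
    modelBracket G (∑ i ∈ s, c i • w i) η = ∑ i ∈ s, c i • modelBracket G (w i) η := by
  classical
  have h0 : modelBracket G 0 η = 0 :=
    zero_lie (L := GroupLieAlgebra 𝓘(ℝ, E) G) (M := GroupLieAlgebra 𝓘(ℝ, E) G) η
  have h1 : ∀ (c : ℝ) (ξ : E), modelBracket G (c • ξ) η = c • modelBracket G ξ η := fun c ξ ↦
    smul_lie (L := GroupLieAlgebra 𝓘(ℝ, E) G) (M := GroupLieAlgebra 𝓘(ℝ, E) G) c ξ η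
  induction s using Finset.induction_on with
  | empty => simpa using h0
  | insert a s ha ih => rw [Finset.sum_insert ha, Finset.sum_insert ha, modelBracket_add_left, h1, ih]

variable [RiemannianBundle (fun x : G ↦ TangentSpace 𝓘(ℝ, E) x)]

lemma modelInner_add_left (v v' w : E) :
    modelInner E G (v + v') w = modelInner E G v w + modelInner E G v' w :=
  inner_add_left (E := TangentSpace 𝓘(ℝ, E) (1 : G)) v v' w

lemma modelInner_smul_left (c : ℝ) (v w : E) :
    modelInner E G (c • v) w = c * modelInner E G v w :=
  real_inner_smul_left (F := TangentSpace 𝓘(ℝ, E) (1 : G)) v w c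

lemma modelInner_comm (v w : E) : modelInner E G v w = modelInner E G w v :=
  real_inner_comm (F := TangentSpace 𝓘(ℝ, E) (1 : G)) w v

lemma modelInner_sum_smul_left {ι : Type*} (s : Finset ι) (c : ι → ℝ) (w : ι → E) (x : E) :
    modelInner E G (∑ i ∈ s, c i • w i) x = ∑ i ∈ s, c i * modelInner E G (w i) x := by
  classical
  induction s using Finset.induction_on with
  | empty => exact inner_zero_left (E := TangentSpace 𝓘(ℝ, E) (1 : G)) x
  | insert a s ha ih =>
    rw [Finset.sum_insert ha, Finset.sum_insert ha, modelInner_add_left, modelInner_smul_left, ih]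

variable (G) in
/-- An orthonormal basis `e, w i` of the Lie algebra, such that `w i` span an abelian ideal, on
which `ad e` has matrix `M`. -/
structure IsAdaptedFrame {ι : Type*} [Fintype ι] [DecidableEq ι] (e : E) (w : ι → E)
    (M : ι → ι → ℝ) : Prop where
  expansion : ∀ x, x = modelInner E G e x • e + ∑ i, modelInner E G (w i) x • w i
  inner_self : modelInner E G e e = 1
  inner_frame : ∀ i, modelInner E G e (w i) = 0
  orthonormal : ∀ i j, modelInner E G (w i) (w j) = if i = j then 1 else 0
  bracket_frame : ∀ i j, modelBracket G (w i) (w j) = 0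
  bracket : ∀ i, modelBracket G e (w i) = ∑ j, M i j • w j

lemma IsAlmostAbelianGroup.exists_isAdaptedFrame (hG : IsAlmostAbelianGroup E G) :
    ∃ (n : ℕ) (e : E) (w : Fin n → E) (M : Fin n → Fin n → ℝ), IsAdaptedFrame G e w M := by
  obtain ⟨𝔥, hab, hdim⟩ := hG
  let S : Set E := (𝔥 : Set (GroupLieAlgebra 𝓘(ℝ, E) G))
  have key : ∃ (e : E) (w : Fin (Module.finrank ℝ 𝔥.toSubmodule) → E),
      (∀ i, w i ∈ S) ∧ modelInner E G e e = 1 ∧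
      (∀ x ∈ S, modelInner E G e x = 0) ∧
      (∀ i j, modelInner E G (w i) (w j) = if i = j then 1 else 0) ∧
      ∀ x, x = modelInner E G e x • e + ∑ i, modelInner E G (w i) x • w i :=
    exists_orthonormal_adapted (V := TangentSpace 𝓘(ℝ, E) (1 : G)) 𝔥.toSubmodule hdim
  obtain ⟨e, w, hw, he, he', hww, hexp⟩ := key
  refine ⟨_, e, w, fun i j ↦ modelInner E G (w j) (modelBracket G e (w i)), hexp, he,
    fun i ↦ he' _ (hw i), hww, fun i j ↦ ?_, fun i ↦ ?_⟩
  · have := LieModule.IsTrivial.trivial (self := hab) (⟨w i, hw i⟩ : 𝔥) (⟨w j, hw j⟩ : 𝔥)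
    exact congrArg Subtype.val this
  · have hmem : modelBracket G e (w i) ∈ S :=
      lie_mem_right ℝ _ 𝔥 e (w i) (hw i)
    have h1 := hexp (modelBracket G e (w i))
    rwa [he' _ hmem, zero_smul, zero_add] at h1

namespace IsAdaptedFrame

variable {ι : Type*} [Fintype ι] [DecidableEq ι] {e : E} {w : ι → E} {M : ι → ι → ℝ}

lemma bracket_apply (h : IsAdaptedFrame G e w M) (a : E) (i : ι) :
    modelBracket G a (w i) = modelInner E G e a • ∑ j, M i j • w j := by
  have h1 : modelBracket G (modelInner E G e a • e) (w i) =
      modelInner E G e a • modelBracket G e (w i) :=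
    smul_lie (L := GroupLieAlgebra 𝓘(ℝ, E) G) (M := GroupLieAlgebra 𝓘(ℝ, E) G) _ e (w i)
  conv_lhs => rw [h.expansion a]
  rw [modelBracket_add_left, modelBracket_sum_smul_left, h1, h.bracket]
  simp [h.bracket_frame]

lemma bracket_normal (h : IsAdaptedFrame G e w M) (a : E) :
    modelBracket G a e = - ∑ i, modelInner E G (w i) a • ∑ j, M i j • w j := by
  have h1 : modelBracket G (modelInner E G e a • e) e = 0 :=
    (smul_lie (L := GroupLieAlgebra 𝓘(ℝ, E) G) (M := GroupLieAlgebra 𝓘(ℝ, E) G) _ e e).trans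
      ((congrArg (fun x ↦ modelInner E G e a • x) (lie_self (L := GroupLieAlgebra 𝓘(ℝ, E) G) e)).trans
        (smul_zero _))
  conv_lhs => rw [h.expansion a]
  rw [modelBracket_add_left, modelBracket_sum_smul_left, h1, zero_add, ← Finset.sum_neg_distrib]
  refine Finset.sum_congr rfl fun i _ ↦ ?_
  rw [modelBracket_swap, h.bracket, smul_neg]

/-- Together with `inner_bracket_normal`, this gives the components of the Euler vector field
required by `symDeriv_polyEval`. -/
lemma inner_bracket_apply (h : IsAdaptedFrame G e w M) (a : E) (i : ι) :
    modelInner E G (modelBracket G a (w i)) a =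
      modelInner E G a e * ∑ j, M i j * modelInner E G a (w j) := by
  rw [h.bracket_apply, modelInner_smul_left, modelInner_sum_smul_left, modelInner_comm e]
  simp only [modelInner_comm a]

lemma inner_bracket_normal (h : IsAdaptedFrame G e w M) (a : E) :
    modelInner E G (modelBracket G a e) a =
      - ∑ i, modelInner E G a (w i) * ∑ j, M i j * modelInner E G a (w j) := by
  rw [h.bracket_normal, modelInner_neg_left, modelInner_sum_smul_left]
  simp only [modelInner_sum_smul_left, modelInner_comm a]

lemma inner_apply_self (h : IsAdaptedFrame G e w M) (a : E) :
    modelInner E G a a = modelInner E G a e ^ 2 + ∑ i, modelInner E G a (w i) ^ 2 := by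
  conv_lhs => rw [h.expansion a]
  rw [modelInner_add_left, modelInner_smul_left, modelInner_sum_smul_left, ← h.expansion a]
  simp only [modelInner_comm a, sq]

lemma span_eq_top (h : IsAdaptedFrame G e w M) :
    Submodule.span ℝ (insert e (Set.range w)) = ⊤ := by
  rw [eq_top_iff]
  intro x _
  rw [h.expansion x]
  refine Submodule.add_mem _ (Submodule.smul_mem _ _ (Submodule.subset_span (Or.inl rfl)))
    (Submodule.sum_mem _ fun i _ ↦ Submodule.smul_mem _ _ (Submodule.subset_span (Or.inr ⟨i, rfl⟩)))

lemma exists_inner_eq (h : IsAdaptedFrame G e w M) (v : ι → ℝ) (s : ℝ) :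
    ∃ a : E, modelInner E G a e = s ∧ ∀ i, modelInner E G a (w i) = v i := by
  refine ⟨s • e + ∑ i, v i • w i, ?_, fun i ↦ ?_⟩
  · rw [modelInner_add_left, modelInner_smul_left, modelInner_sum_smul_left, h.inner_self]
    simp [modelInner_comm _ e, h.inner_frame]
  · rw [modelInner_add_left, modelInner_smul_left, modelInner_sum_smul_left, h.inner_frame]
    simp [h.orthonormal]

end IsAdaptedFrame

end AdaptedFrame

/-! ### The Killing equation as a first integral condition -/

section KillingEquation

variable {E : Type*} [NormedAddCommGroup E] [NormedSpace ℝ E] [FiniteDimensional ℝ E]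
  {G : Type*} [TopologicalSpace G] [ChartedSpace E G] [Group G] [LieGroup 𝓘(ℝ, E) ∞ G]
  [RiemannianBundle (fun x : G ↦ TangentSpace 𝓘(ℝ, E) x)]
  [IsContMDiffRiemannianBundle 𝓘(ℝ, E) ∞ E (fun x : G ↦ TangentSpace 𝓘(ℝ, E) x)]

lemma leftForm_one (β : E →ₗ[ℝ] ℝ) : (leftForm β (1 : G) : E →ₗ[ℝ] ℝ) = β := by
  have h := leftForm_comp_leftD (G := G) β 1
  have h1 : (leftD E (1 : G)).toLinearMap = LinearMap.id :=
    LinearMap.ext fun ξ ↦ leftField_one (G := G) ξ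
  rw [h1] at h
  exact h

/-- The Killing equation of a left-invariant symmetric tensor, at the identity. -/
lemma IsKillingTensor.symDeriv_eq_zero (hg : IsLeftInvariantMetric E G) {p : ℕ} {K : SymField E G}
    (hK : IsKillingTensor p K) (hinv : K.IsLeftInvariant) (a : E) {α γ : E →ₗ[ℝ] ℝ}
    (hα : ∀ v, α v = modelInner E G a v)
    (hγ : ∀ v, γ v = modelInner E G (modelBracket G a v) a) :
    symDeriv (V := E) α γ (K 1) = 0 := by
  obtain ⟨-, cov, hcov, hD⟩ := hK
  obtain ⟨D, hD, hsum⟩ := hD 1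
  let b := tangentONB E G 1
  have hconst : (fun u ↦ symEval (leftForm α u) (K u)) = fun _ ↦ symEval (V := E) α (K 1) :=
    funext fun u ↦ hinv.symEval_leftForm α u
  have h1 : ∀ v, symEval (leftForm α 1) (D v) =
      symDeriv (leftForm α 1) (leftForm α 1 ∘ₗ leftConnection cov 1 v) (K 1) := by
    intro v
    have h2 : mvfderiv 𝓘(ℝ, E) (fun _ : G ↦ symEval (V := E) α (K 1)) 1 = 0 := mvfderiv_const _
    rw [(hD.symEval_leftForm α).2 v, hconst, h2]
    exact zero_add _
  let aT : TangentSpace 𝓘(ℝ, E) (1 : G) := a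
  have h2 : ∀ v : TangentSpace 𝓘(ℝ, E) (1 : G), leftForm α 1 v = inner ℝ aT v := fun v ↦
    (DFunLike.congr_fun (leftForm_one (G := G) α) v).trans (hα v)
  have h3 := congrArg (symEval (leftForm α 1)) hsum
  simp only [map_sum, map_mul, map_zero, symEval_ι, h1] at h3
  rw [← symDeriv_sum_smul] at h3
  have h4 : ∑ i, leftForm α 1 (b i) • b i = aT := by
    simp only [h2]
    refine Eq.trans (Finset.sum_congr rfl fun i _ ↦ ?_) (b.sum_repr' aT)
    rw [real_inner_comm]
  -- The connection is linear in its direction, so the sum contracts to `∇_a`. What remains is `⟨∇_a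
  -- v, a⟩`, equal to `⟨[a, v], a⟩` by `inner_cov_leftField`.
  have h5 : (∑ i, leftForm α 1 (b i) • (leftForm α 1 ∘ₗ leftConnection cov 1 (b i))) =
      (γ : TangentSpace 𝓘(ℝ, E) (1 : G) →ₗ[ℝ] ℝ) := by
    apply LinearMap.ext
    intro v
    change E at v
    have h6 : ∀ ξ : E, leftDInv E (1 : G) ξ = ξ := fun ξ ↦ by
      conv_lhs => rw [← leftField_one (G := G) ξ]
      exact leftCoord_leftField ξ 1
    have h7 : leftField G (leftDInv E (1 : G) v) = leftField G v := congrArg (leftField G) (h6 v)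
    have h8 := inner_cov_leftField hg hcov a v 1
    rw [leftField_one] at h8
    have h9 : leftConnection cov 1 aT v = cov (leftField G v) 1 aT :=
      congrFun (congrArg (fun X : VField E G ↦ (cov X 1 : E → E)) h7) a
    have h10 : ∑ i, leftForm α 1 (b i) • leftConnection cov 1 (b i) v =
        leftConnection cov 1 aT v := by
      rw [← h4]
      simp only [leftConnection, LinearMap.coe_mk, AddHom.coe_mk, map_sum, map_smul]
    refine (LinearMap.sum_apply Finset.univ
      (fun i ↦ leftForm α 1 (b i) • (leftForm α 1 ∘ₗ leftConnection cov 1 (b i))) v).trans ?_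
    have h11 := congrArg (leftForm α 1) (h10.trans h9)
    rw [map_sum, h2, real_inner_comm] at h11
    simp only [map_smul] at h11
    exact h11.trans (h8.trans (hγ v).symm)
  rw [h5] at h3
  have h6 : ∀ α' : E →ₗ[ℝ] ℝ, α' = α → symDeriv (V := E) α' γ (K 1) = 0 →
      symDeriv (V := E) α γ (K 1) = 0 := by
    rintro _ rfl h
    exact h
  exact h6 _ (leftForm_one (G := G) α) h3

end KillingEquation

/-! ### Decomposition of left-invariant Killing tensors -/

section Decomposition

open Polynomial

lemma polyEval_comp {ι S : Type*} [CommRing S] [Algebra ℝ S] (w : ι → S) (e : S)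
    (a p : (MvPolynomial ι ℝ)[X]) :
    polyEval w e (a.comp p) = polyEval w (polyEval w e p) a := by
  induction a using Polynomial.induction_on' with
  | add p q hp hq => simp only [add_comp, map_add, hp, hq]
  | monomial n c =>
    rw [← C_mul_X_pow_eq_monomial]
    simp only [mul_comp, C_comp, pow_comp, X_comp, map_mul, map_pow, polyEval_X, polyEval_C]

lemma map_aeval_mvPolynomial {ι S T : Type*} [CommRing S] [Algebra ℝ S] [CommRing T] [Algebra ℝ T]
    (φ : S →ₐ[ℝ] T) (w : ι → S) (c : MvPolynomial ι ℝ) :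
    φ (MvPolynomial.aeval w c) = MvPolynomial.aeval (fun i ↦ φ (w i)) c := by
  simpa [polyEval_C] using map_polyEval φ w 0 (C c)

lemma symMap_polyEval {ι V W : Type*} [AddCommGroup V] [Module ℝ V] [AddCommGroup W] [Module ℝ W]
    (f : V →ₗ[ℝ] W) (w : ι → V) (e : V) (k : (MvPolynomial ι ℝ)[X]) :
    symMap f (polyEval (fun i ↦ SymmetricAlgebra.ι ℝ V (w i)) (SymmetricAlgebra.ι ℝ V e) k) =
      polyEval (fun i ↦ SymmetricAlgebra.ι ℝ W (f (w i))) (SymmetricAlgebra.ι ℝ W (f e)) k := by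
  simp only [map_polyEval, symMap_ι]

lemma polyEval_mem {ι S : Type*} [CommRing S] [Algebra ℝ S] (A : Subalgebra ℝ S) {w : ι → S} {e : S}
    {a : (MvPolynomial ι ℝ)[X]} (he : e ∈ A)
    (ha : ∀ n, MvPolynomial.aeval w (a.coeff n) ∈ A) : polyEval w e a ∈ A := by
  rw [a.as_sum_range_C_mul_X_pow, map_sum]
  refine A.sum_mem fun n _ ↦ ?_
  rw [map_mul, map_pow, polyEval_C, polyEval_X]
  exact A.mul_mem (ha n) (A.pow_mem he n)

variable {E : Type*} [NormedAddCommGroup E] [NormedSpace ℝ E]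
  {G : Type*} [TopologicalSpace G] [ChartedSpace E G]

lemma mvfderiv_aeval {ι : Type*} [Fintype ι] (M : ι → ι → ℝ) {φ : ι → G → ℝ} {u : G}
    (hφ : ∀ i, MDifferentiableAt 𝓘(ℝ, E) 𝓘(ℝ, ℝ) (φ i) u) (c : MvPolynomial ι ℝ) :
    MDifferentiableAt 𝓘(ℝ, E) 𝓘(ℝ, ℝ) (fun y ↦ MvPolynomial.aeval (fun i ↦ φ i y) c) u ∧
      ∀ v t, (∀ i, mvfderiv 𝓘(ℝ, E) (φ i) u v = t * ∑ j, M i j * φ j u) →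
        mvfderiv 𝓘(ℝ, E) (fun y ↦ MvPolynomial.aeval (fun i ↦ φ i y) c) u v =
          t * MvPolynomial.aeval (fun i ↦ φ i u) (linearDerivation M c) := by
  induction c using MvPolynomial.induction_on with
  | C a =>
    simp only [MvPolynomial.aeval_C]
    refine ⟨mdifferentiableAt_const, fun v t _ ↦ ?_⟩
    have h2 : mvfderiv 𝓘(ℝ, E) (fun _ : G ↦ algebraMap ℝ ℝ a) u = 0 := mvfderiv_const _
    rw [h2, ← MvPolynomial.algebraMap_eq, Derivation.map_algebraMap, map_zero, mul_zero]
    rfl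
  | add p q hp hq =>
    simp only [map_add]
    refine ⟨hp.1.add hq.1, fun v t h ↦ ?_⟩
    rw [mvfderiv_fun_add hp.1 hq.1, add_apply, hp.2 v t h, hq.2 v t h, mul_add]
  | mul_X p i hp =>
    simp only [map_mul, MvPolynomial.aeval_X]
    refine ⟨hp.1.mul (hφ i), fun v t h ↦ ?_⟩
    rw [mvfderiv_fun_mul hp.1 (hφ i), Derivation.leibniz]
    simp only [add_apply, smul_apply, smul_eq_mul, hp.2 v t h, h,
      linearDerivation, MvPolynomial.mkDerivation_X, map_add, map_mul,
      map_sum, MvPolynomial.aeval_X, MvPolynomial.aeval_C, Algebra.algebraMap_self, RingHom.id_apply]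
    ring

variable [Group G] [LieGroup 𝓘(ℝ, E) ∞ G]

lemma exists_rightField_eq (u : G) (v : TangentSpace 𝓘(ℝ, E) u) : ∃ η : E, rightField G η u = v := by
  have key : ∀ x : E, ∃ η : E, rightField G η u = leftField G x u := by
    intro x
    refine ⟨adInv E u⁻¹ x, ?_⟩
    rw [← leftField_leftCoord (rightField G _) u, leftCoord_rightField]
    have h := adInv_mul (E := E) u⁻¹ u
    rw [inv_mul_cancel, adInv_one] at h
    exact congrArg (fun x ↦ leftField G x u) (DFunLike.congr_fun h x).symm
  obtain ⟨η, hη⟩ := key (leftDInv E u v)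
  exact ⟨η, hη.trans (DFunLike.congr_fun (leftD_comp_leftDInv (E := E) u) v)⟩

lemma exists_leftField_eq (u : G) (v : TangentSpace 𝓘(ℝ, E) u) : ∃ a : E, leftField G a u = v :=
  ⟨leftDInv E u v, DFunLike.congr_fun (leftD_comp_leftDInv (E := E) u) v⟩

variable [FiniteDimensional ℝ E]
  [RiemannianBundle (fun x : G ↦ TangentSpace 𝓘(ℝ, E) x)]
  {n : ℕ} {e : E} {w : Fin n → E} {M : Fin n → Fin n → ℝ}

namespace IsAdaptedFrame

/-! ### Exchanging left-invariant and right-invariant fields -/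

section Torsion

variable {cov : CovariantDerivative 𝓘(ℝ, E) E (fun x : G ↦ TangentSpace 𝓘(ℝ, E) x)}

/-- Polynomials on the ideal that are invariant under the derivation `M` are `Ad`-invariant. -/
lemma aeval_adInv [ConnectedSpace G] (h : IsAdaptedFrame G e w M) (hcov : cov.torsion = 0)
    {c : MvPolynomial (Fin n) ℝ}
    (hc : linearDerivation M c = 0) (β : E →ₗ[ℝ] ℝ) (u : G) :
    MvPolynomial.aeval (fun i ↦ β (adInv E u (w i))) c =
      MvPolynomial.aeval (fun i ↦ β (w i)) c := by
  have h1 : ∀ i u, HasMFDerivAt 𝓘(ℝ, E) 𝓘(ℝ, ℝ) (fun u : G ↦ β (adInv E u (w i))) u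
      (β.toContinuousLinearMap ∘L mvfderiv 𝓘(ℝ, E) (fun u : G ↦ adInv E u (w i)) u) := fun i u ↦
    hasMFDerivAt_clm_comp (mdifferentiableAt_adInv (w i) u) β.toContinuousLinearMap
  have h2 := fun u ↦ mvfderiv_aeval (E := E) M (fun i ↦ (h1 i u).mdifferentiableAt) c
  have h3 : ∀ u : G, mvfderiv 𝓘(ℝ, E)
      (fun u : G ↦ MvPolynomial.aeval (fun i ↦ β (adInv E u (w i))) c) u = 0 := by
    intro u
    ext v
    -- Along a right-invariant direction the bracket is formed inside `adInv`: the derivative of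
    -- `adInv u (w i)` is `adInv u [w i, η]`. There the ideal being abelian leaves only `-⟨e, η⟩`
    -- times row `i` of `M`, so the polynomial changes by a multiple of `linearDerivation M c`.
    obtain ⟨η, rfl⟩ := exists_rightField_eq u v
    rw [(h2 u).2 _ (- modelInner E G e η) ?_, hc, map_zero, mul_zero]
    · rfl
    intro i
    have h4 : mvfderiv 𝓘(ℝ, E) (fun u : G ↦ β (adInv E u (w i))) u (rightField G η u) =
        β (mvfderiv 𝓘(ℝ, E) (fun u : G ↦ adInv E u (w i)) u (rightField G η u)) :=
      DFunLike.congr_fun (h1 i u).mfderiv _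
    rw [h4, mvfderiv_adInv_rightField hcov, modelBracket_swap, h.bracket_apply]
    simp
  have h5 := eq_of_mfderiv_eq_zero (fun u ↦ (h2 u).1) h3 u 1
  rw [h5, adInv_one]
  rfl

/-- The invariant polynomials on the ideal define the same tensors by means of left-invariant or of
right-invariant vector fields. -/
lemma aeval_leftField [ConnectedSpace G] (h : IsAdaptedFrame G e w M) (hcov : cov.torsion = 0)
    {c : MvPolynomial (Fin n) ℝ} (hc : linearDerivation M c = 0) :
    MvPolynomial.aeval (fun i ↦ SymField.ofVField (leftField G (w i))) c =
      MvPolynomial.aeval (fun i ↦ SymField.ofVField (rightField G (w i))) c := by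
  funext u
  apply symEval_injective
  intro α
  let β : E →ₗ[ℝ] ℝ := α ∘ₗ (leftD E u).toLinearMap
  let φ := (symEval α).comp
    (Pi.evalAlgHom ℝ (fun u : G ↦ SymmetricAlgebra ℝ (TangentSpace 𝓘(ℝ, E) u)) u)
  have h1 : ∀ X : VField E G, φ (SymField.ofVField X) = β (leftCoord X u) := fun X ↦ by
    refine (symEval_ι α (X u)).trans ?_
    exact congrArg α (leftField_leftCoord X u).symm
  have h2 := map_aeval_mvPolynomial φ (fun i ↦ SymField.ofVField (leftField G (w i))) c
  have h3 := map_aeval_mvPolynomial φ (fun i ↦ SymField.ofVField (rightField G (w i))) c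
  simp only [h1, leftCoord_leftField, leftCoord_rightField] at h2 h3
  exact h2.trans ((h.aeval_adInv hcov hc β u).symm.trans h3.symm)

end Torsion

variable [IsContMDiffRiemannianBundle 𝓘(ℝ, E) ∞ E (fun x : G ↦ TangentSpace 𝓘(ℝ, E) x)]

lemma eq_polyEval_leftField {K : SymField E G} (hinv : K.IsLeftInvariant)
    {k : (MvPolynomial (Fin n) ℝ)[X]}
    (hk : polyEval (fun i ↦ SymmetricAlgebra.ι ℝ E (w i)) (SymmetricAlgebra.ι ℝ E e) k = K 1) :
    K = polyEval (fun i ↦ SymField.ofVField (leftField G (w i))) (SymField.ofVField (leftField G e))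
      k := by
  funext u
  have h1 := map_polyEval
    (Pi.evalAlgHom ℝ (fun u : G ↦ SymmetricAlgebra ℝ (TangentSpace 𝓘(ℝ, E) u)) u)
    (fun i ↦ SymField.ofVField (leftField G (w i))) (SymField.ofVField (leftField G e)) k
  refine (hinv.symMap_leftD u).symm.trans (Eq.trans ?_ h1.symm)
  rw [← hk]
  exact symMap_polyEval (W := TangentSpace 𝓘(ℝ, E) u) (leftD E u).toLinearMap w e k

lemma two_smul_metricTensor (h : IsAdaptedFrame G e w M) (hg : IsLeftInvariantMetric E G) :
    polyEval (fun i ↦ SymField.ofVField (leftField G (w i))) (SymField.ofVField (leftField G e))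
      (X ^ 2 + C (normSqPoly (Fin n))) = (2 : ℝ) • metricTensor E G := by
  funext u
  apply symEval_injective
  intro α
  obtain ⟨a', ha⟩ := (InnerProductSpace.toDual ℝ (TangentSpace 𝓘(ℝ, E) u)).surjective
    α.toContinuousLinearMap
  have hα : ∀ v, α v = inner ℝ a' v := fun v ↦ by
    rw [← InnerProductSpace.toDual_apply_apply, ha]
    rfl
  obtain ⟨a, rfl⟩ := exists_leftField_eq u a'
  let φ := (symEval α).comp
    (Pi.evalAlgHom ℝ (fun u : G ↦ SymmetricAlgebra ℝ (TangentSpace 𝓘(ℝ, E) u)) u)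
  have h1 := map_polyEval φ (fun i ↦ SymField.ofVField (leftField G (w i)))
    (SymField.ofVField (leftField G e)) (X ^ 2 + C (normSqPoly (Fin n)))
  have h2 : ∀ x, φ (SymField.ofVField (leftField G x)) = modelInner E G a x := fun x ↦
    (symEval_ι α _).trans ((hα _).trans (inner_leftField hg a x u))
  have h3 : symEval α (((2 : ℝ) • metricTensor E G) u) = modelInner E G a a := by
    rw [← inner_leftField hg a a u, Pi.smul_apply, metricTensor, smul_smul]
    simp only [map_smul, map_sum, map_mul, symEval_ι, hα]
    rw [← (tangentONB E G u).sum_inner_mul_inner]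
    simp [real_inner_comm]
  refine Eq.trans h1 (Eq.trans ?_ h3.symm)
  simp only [h2, map_add, map_pow, polyEval_X, polyEval_C, normSqPoly, map_sum,
    MvPolynomial.aeval_X]
  exact (h.inner_apply_self a).symm

/-- The equation at the identity holds at every linear form, and adapted coordinates take all real
values, so it is an identity of polynomials. -/
lemma killing_equation (h : IsAdaptedFrame G e w M) (hg : IsLeftInvariantMetric E G) {p : ℕ}
    {K : SymField E G} (hK : IsKillingTensor p K) (hinv : K.IsLeftInvariant)
    {k : (MvPolynomial (Fin n) ℝ)[X]}
    (hk : polyEval (fun i ↦ SymmetricAlgebra.ι ℝ E (w i)) (SymmetricAlgebra.ι ℝ E e) k = K 1) :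
    X * coeffDerivation (linearDerivation M) k - C (quadPoly M) * derivative k = 0 := by
  apply eq_zero_of_polyEval_eq_zero
  intro v s
  obtain ⟨a, rfl, hv⟩ := h.exists_inner_eq v s
  obtain rfl : (fun i ↦ modelInner E G a (w i)) = v := funext hv
  let α : E →ₗ[ℝ] ℝ := (innerₗ (TangentSpace 𝓘(ℝ, E) (1 : G)) a : _ →ₗ[ℝ] ℝ)
  let γ : E →ₗ[ℝ] ℝ :=
    { toFun := fun v ↦ modelInner E G (modelBracket G a v) a
      map_add' := fun v v' ↦ by
        simp only [modelBracket_swap a, modelBracket_add_left, modelInner_neg_left,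
          modelInner_add_left, neg_add]
      map_smul' := fun c v ↦ by
        have h1 : modelBracket G a (c • v) = c • modelBracket G a v :=
          lie_smul (L := GroupLieAlgebra 𝓘(ℝ, E) G) (M := GroupLieAlgebra 𝓘(ℝ, E) G) c a v
        rw [h1, modelInner_smul_left]
        rfl }
  refine (symDeriv_polyEval M w e α γ (fun i ↦ h.inner_bracket_apply a i)
    (h.inner_bracket_normal a) k).symm.trans ?_
  rw [hk]
  exact hK.symDeriv_eq_zero hg hinv a (fun _ ↦ rfl) (fun _ ↦ rfl)

lemma isKillingVField_rightField
    {cov : CovariantDerivative 𝓘(ℝ, E) E (fun x : G ↦ TangentSpace 𝓘(ℝ, E) x)}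
    (hg : IsLeftInvariantMetric E G) (hcov : IsLeviCivita cov) (ξ : E) :
    IsKillingVField (rightField G ξ) := by
  refine isKillingVField_of_inner_eq_zero hcov (fun u ↦ contMDiff_rightField ξ u) fun u v ↦ ?_
  obtain ⟨a, rfl⟩ := exists_leftField_eq u v
  exact inner_cov_rightField hg hcov ξ a u

/-- Here `⟨∇_a e, a⟩` is minus the value at `a` of the quadratic form of `M`. -/
lemma isKillingVField_leftField (h : IsAdaptedFrame G e w M)
    {cov : CovariantDerivative 𝓘(ℝ, E) E (fun x : G ↦ TangentSpace 𝓘(ℝ, E) x)}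
    (hg : IsLeftInvariantMetric E G) (hcov : IsLeviCivita cov) (hQ : quadPoly M = 0) :
    IsKillingVField (leftField G e) := by
  refine isKillingVField_of_inner_eq_zero hcov (fun u ↦ contMDiff_leftField e u) fun u v ↦ ?_
  obtain ⟨a, rfl⟩ := exists_leftField_eq u v
  have h1 := congrArg (MvPolynomial.aeval (fun i ↦ modelInner E G a (w i))) hQ
  simp only [quadPoly, map_sum, map_mul, MvPolynomial.aeval_X, MvPolynomial.aeval_C, map_zero,
    Algebra.algebraMap_self, RingHom.id_apply] at h1
  rw [inner_cov_leftField hg hcov, h.inner_bracket_normal, h1, neg_zero]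

end IsAdaptedFrame

end Decomposition

end

theorem theorem5p2
    {E : Type*} [NormedAddCommGroup E] [NormedSpace ℝ E] [FiniteDimensional ℝ E]
    {G : Type*} [TopologicalSpace G] [ChartedSpace E G] [Group G]
    [LieGroup 𝓘(ℝ, E) ∞ G] [ConnectedSpace G]
    (hG : IsAlmostAbelianGroup E G)
    [RiemannianBundle (fun x : G ↦ TangentSpace 𝓘(ℝ, E) x)]
    [IsContMDiffRiemannianBundle 𝓘(ℝ, E) ∞ E (fun x : G ↦ TangentSpace 𝓘(ℝ, E) x)]
    (hg : IsLeftInvariantMetric E G)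
    (p : ℕ) (K : SymField E G) (hK : IsKillingTensor p K) (hinv : K.IsLeftInvariant) :
    K ∈ Algebra.adjoin ℝ ({metricTensor E G} ∪
        {S : SymField E G | ∃ X : VField E G, IsKillingVField X ∧
          (VField.IsRightInvariant X ∨ VField.IsLeftInvariant X) ∧ S = SymField.ofVField X}) ∧
      IsDecomposable p K := by
  set A := Algebra.adjoin ℝ ({metricTensor E G} ∪
        {S : SymField E G | ∃ X : VField E G, IsKillingVField X ∧
          (VField.IsRightInvariant X ∨ VField.IsLeftInvariant X) ∧ S = SymField.ofVField X}) with hA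
  have hmem : K ∈ A := by
    obtain ⟨n, e, w, M, hf⟩ := hG.exists_isAdaptedFrame
    obtain ⟨-, cov, hcov, -⟩ := id hK
    obtain ⟨k, hk⟩ := polyEval_surjective w e hf.span_eq_top (K 1)
    obtain ⟨a, b, hab, ha, hb, hbQ⟩ := exists_energy_decomposition (linearDerivation M)
      (linearDerivation_normSqPoly M) (hf.killing_equation hg hK hinv hk)
    have hcoeff : ∀ c, linearDerivation M c = 0 →
        MvPolynomial.aeval (fun i ↦ SymField.ofVField (leftField G (w i))) c ∈ A := by
      intro c hc
      rw [hf.aeval_leftField hcov.torsionFree hc]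
      have h1 : MvPolynomial.aeval (fun i ↦ SymField.ofVField (rightField G (w i))) c ∈
          Algebra.adjoin ℝ (Set.range fun i ↦ SymField.ofVField (rightField G (w i))) := by
        rw [← MvPolynomial.aeval_range]
        exact ⟨c, rfl⟩
      refine Algebra.adjoin_mono ?_ h1
      rintro _ ⟨i, rfl⟩
      exact Or.inr ⟨_, IsAdaptedFrame.isKillingVField_rightField hg hcov (w i),
        Or.inl (rightField_isRightInvariant (w i)), rfl⟩
    have hpoly : ∀ a, coeffDerivation (linearDerivation M) a = 0 →
        polyEval (fun i ↦ SymField.ofVField (leftField G (w i)))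
          (SymField.ofVField (leftField G e)) (a.comp (.X ^ 2 + .C (normSqPoly (Fin n)))) ∈ A := by
      intro a ha
      rw [polyEval_comp, hf.two_smul_metricTensor hg]
      -- Substituting the energy for the variable of `a` leaves a polynomial in twice the metric,
      -- whose coefficients are killed by `linearDerivation M`.
      refine polyEval_mem A (A.smul_mem (Algebra.subset_adjoin (Or.inl rfl)) 2) fun m ↦ hcoeff _ ?_
      rw [← coeff_coeffDerivation, ha, Polynomial.coeff_zero]
    rw [IsAdaptedFrame.eq_polyEval_leftField hinv hk, hab, map_add, map_mul, polyEval_X]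
    refine A.add_mem (hpoly a ha) ?_
    -- The odd part either vanishes or carries the left-invariant field of `e` as a factor, and in
    -- the latter case that field is Killing.
    rcases hbQ with rfl | hQ
    · simp
    · exact A.mul_mem (Algebra.subset_adjoin (Or.inr ⟨_, hf.isKillingVField_leftField hg hcov hQ,
        Or.inr (leftField_isLeftInvariant e), rfl⟩)) (hpoly b hb)
  refine ⟨hmem, hK, Algebra.adjoin_mono (Set.union_subset_union_right _ ?_) hmem⟩
  rintro S ⟨X, hX, -, rfl⟩
  exact ⟨X, hX, rfl⟩
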